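/- **Theorem (Diaz–Saa inequality).** Let $N\ge 1$, let $\Omega\subset\mathbb R^N$ be a bounded domain (nonempty, open, connected), let $p\in C(\overline\Omega)$ with $p(x)>1$ for all $x\in\overline\Omega$, and put $p_-=\min_{\overline\Omega}p$. Let $W^{1,p(x)}(\Omega)$ be the space of measurable $u$ with $\int_\Omega|u|^{p(x)}dx<\infty$ that have a weak gradient with $\int_\Omega|\nabla u|^{p(x)}dx<\infty$, and $W_0^{1,p(x)}(\Omega)=W_0^{1,1}(\Omega)\cap W^{1,p(x)}(\Omega)$, where $W^{1,1}_0(\Omega)$ is the closure of $C_c^\infty(\Omega)$ in $W^{1,1}(\Omega)$. Let $A:\Omega\times\mathbb R^N\to\mathbb R$ be continuous, differentiable in $\xi$, and such that * (A1) $A(x,t\xi)=t^{p(x)}A(x,\xi)$ for all $t>0$, $\xi\in\mathbb R^N$ and a.e. $x\in\Omega$; * (A2) $\xi\mapsto A(x,\xi)$ is strictly convex for every $x\in\Omega$. Put $a(x,\xi)=\frac1{p(x)}\partial_\xi A(x,\xi)$ and assume that $a\in C^1(\Omega\times(\mathbb R^N\setminus\{0\}))^N$ and that for some $\Lambda>0$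 $$\sum_{i,j=1}^N\Big|\frac{\partial a_i}{\partial\xi_j}(x,\xi)\Big|\le\Lambda|\xi|^{p(x)-2}\qquad\text{for all }x\in\Omega,\ \xi\in\mathbb R^N\setminus\{0\}.$$ Let $r\in[1,p_-]$ and let $w_1,w_2\in W_0^{1,p(x)}(\Omega)$ be positive a.e. in $\Omega$ with $w_1/w_2,\ w_2/w_1\in L^\infty(\Omega)$. Then $\varphi_i:=\dfrac{w_1^r-w_2^r}{w_i^{r-1}}\in W_0^{1,p(x)}(\Omega)$ and $a(x,\nabla w_i)\cdot\nabla\varphi_i\in L^1(\Omega)$ for $i=1,2$, and $$\int_\Omega\Big(-\frac{\operatorname{div}a(x,\nabla w_1)}{w_1^{r-1}}+\frac{\operatorname{div}a(x,\nabla w_2)}{w_2^{r-1}}\Big)(w_1^r-w_2^r)\,dx\ \ge\ 0$$ in the sense of distributions, i.e. the left-hand side being understood as $\int_\Omega a(x,\nabla w_1)\cdot\nabla\varphi_1\,dx-\int_\Omega a(x,\nabla w_2)\cdot\nabla\varphi_2\,dx$. Suppose moreover that equality holds. * If $w_1$ and $w_2$ are locally bounded away from zero, i.e. $\operatorname{ess\,inf}_Kw_i>0$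 for every compact $K\subset\Omega$ (for instance if they are continuous and positive at every point of $\Omega$), then $w_1/w_2$ is a.e. equal to a constant in $\Omega$. If in addition $p\not\equiv r$ and $\nabla w_1$ does not vanish a.e. on the set $\{x\in\Omega:p(x)\neq r\}$, then $w_1=w_2$ a.e. in $\Omega$. * If $p(x)\ne r$ for a.e. $x\in\Omega$ (in particular if $r<p_-$), then $w_1=w_2$ a.e. in $\Omega$, without these further conditions on $w_1,w_2$. -/

import Mathlib

open Set MeasureTheory Filter Topology
open scoped ContDiff InnerProductSpace

noncomputable section

namespace DiazSaa

/-- Euclidean space of dimension `N`. -/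
abbrev E (N : ℕ) : Type := EuclideanSpace ℝ (Fin N)

/-- Test functions: smooth functions with compact support contained in `Ω`. -/
def IsTestFunction {N : ℕ} (Ω : Set (E N)) (φ : E N → ℝ) : Prop :=
  ContDiff ℝ ∞ φ ∧ HasCompactSupport φ ∧ tsupport φ ⊆ Ω

/-- `G` is a weak gradient of `u` on `Ω`. -/
def HasWeakGradient {N : ℕ} (Ω : Set (E N)) (u : E N → ℝ) (G : E N → E N) : Prop :=
  LocallyIntegrableOn u Ω ∧ LocallyIntegrableOn G Ω ∧
    ∀ φ : E N → ℝ, IsTestFunction Ω φ → ∀ i : Fin N,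
      ∫ x in Ω, u x * fderiv ℝ φ x (EuclideanSpace.single i 1) = -∫ x in Ω, G x i * φ x

open Classical in
/-- The weak gradient of `u` on `Ω` (unique up to a null set when it exists; `0` if there is
none). -/
def weakGrad {N : ℕ} (Ω : Set (E N)) (u : E N → ℝ) : E N → E N :=
  if h : ∃ G : E N → E N, HasWeakGradient Ω u G then Classical.choose h else 0

/-- The variable exponent Lebesgue space: `u` is measurable on `Ω` and
`∫_Ω |u|^{p(x)} dx < ∞` (for scalar or vector valued `u`). -/
def MemLpVar {N : ℕ} {F : Type*} [NormedAddCommGroup F] (Ω : Set (E N)) (p : E N → ℝ)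
    (u : E N → F) : Prop :=
  AEStronglyMeasurable u (volume.restrict Ω) ∧ ∫⁻ x in Ω, ‖u x‖ₑ ^ p x < ⊤

/-- The variable exponent Sobolev space `W^{1,p(x)}(Ω)`. -/
def MemW {N : ℕ} (Ω : Set (E N)) (p : E N → ℝ) (u : E N → ℝ) : Prop :=
  MemLpVar Ω p u ∧ HasWeakGradient Ω u (weakGrad Ω u) ∧ MemLpVar Ω p (weakGrad Ω u)

/-- `W_0^{1,1}(Ω)`: the closure of the test functions in `W^{1,1}(Ω)`. -/
def MemW0One {N : ℕ} (Ω : Set (E N)) (u : E N → ℝ) : Prop :=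
  MemW Ω (fun _ => 1) u ∧
    ∃ φ : ℕ → E N → ℝ, (∀ n, IsTestFunction Ω (φ n)) ∧
      Tendsto (fun n => (∫⁻ x in Ω, ‖φ n x - u x‖ₑ) +
        ∫⁻ x in Ω, ‖gradient (φ n) x - weakGrad Ω u x‖ₑ) atTop (𝓝 0)

/-- `W_0^{1,p(x)}(Ω) = W_0^{1,1}(Ω) ∩ W^{1,p(x)}(Ω)`. -/
def MemW0 {N : ℕ} (Ω : Set (E N)) (p : E N → ℝ) (u : E N → ℝ) : Prop :=
  MemW0One Ω u ∧ MemW Ω p u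

/-- `p_-`, the minimum of `p` over the closure of `Ω`. -/
def pMinus {N : ℕ} (Ω : Set (E N)) (p : E N → ℝ) : ℝ := sInf (p '' closure Ω)

/-- `a(x,ξ) = (1/p(x)) ∂_ξ A(x,ξ)`. -/
def flux {N : ℕ} (p : E N → ℝ) (A : E N → E N → ℝ) (x ξ : E N) : E N :=
  (1 / p x) • gradient (A x) ξ

/-- The standing assumptions on `A`: it is continuous on `Ω × ℝ^N`, differentiable in `ξ`,
positively `p(x)`-homogeneous in `ξ` for a.e. `x`, and strictly convex in `ξ`. -/
structure IsAdmissible {N : ℕ} (Ω : Set (E N)) (p : E N → ℝ) (A : E N → E N → ℝ) : Prop where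
  continuousOn : ContinuousOn (fun z : E N × E N => A z.1 z.2) (Ω ×ˢ univ)
  differentiable : ∀ x ∈ Ω, Differentiable ℝ (A x)
  homogeneous : ∀ᵐ x ∂(volume.restrict Ω), ∀ t : ℝ, 0 < t → ∀ ξ : E N,
    A x (t • ξ) = t ^ p x * A x ξ
  strictConvex : ∀ x ∈ Ω, StrictConvexOn ℝ univ (A x)

/-- `a` is `C¹` on `Ω × (ℝ^N ∖ {0})` and
`∑_{i,j} |∂a_i/∂ξ_j (x,ξ)| ≤ Λ |ξ|^{p(x)-2}` there. -/
structure HasDerivBound {N : ℕ} (Ω : Set (E N)) (p : E N → ℝ) (a : E N → E N → E N)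
    (Λ : ℝ) : Prop where
  contDiffOn : ContDiffOn ℝ 1 (fun z : E N × E N => a z.1 z.2) (Ω ×ˢ {0}ᶜ)
  bound : ∀ x ∈ Ω, ∀ ξ : E N, ξ ≠ 0 →
    ∑ i : Fin N, ∑ j : Fin N,
      |fderiv ℝ (fun η : E N => a x η i) ξ (EuclideanSpace.single j 1)| ≤ Λ * ‖ξ‖ ^ (p x - 2)

/-- The integrand `a(x,∇w) · ∇φ`. -/
def fluxDensity {N : ℕ} (Ω : Set (E N)) (a : E N → E N → E N) (w φ : E N → ℝ) (x : E N) : ℝ :=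
  ⟪a x (weakGrad Ω w x), weakGrad Ω φ x⟫_ℝ

/-- The action `⟨-div a(x,∇w), φ⟩ = ∫_Ω a(x,∇w) · ∇φ dx` of the distribution
`-div a(x,∇w)`, for `φ` in `W_0^{1,p(x)}(Ω)`. -/
def negDivPairing {N : ℕ} (Ω : Set (E N)) (a : E N → E N → E N) (w φ : E N → ℝ) : ℝ :=
  ∫ x in Ω, fluxDensity Ω a w φ x

/-- The function `(w₁^r - w₂^r) / w^{r-1}`. -/
def quotTest {N : ℕ} (r : ℝ) (w₁ w₂ w : E N → ℝ) (x : E N) : ℝ :=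
  (w₁ x ^ r - w₂ x ^ r) / w x ^ (r - 1)

/-- The expression
`∫_Ω (-div a(x,∇w₁) / w₁^{r-1} + div a(x,∇w₂) / w₂^{r-1}) (w₁^r - w₂^r) dx`
in the sense of distributions. -/
def diazSaaForm {N : ℕ} (Ω : Set (E N)) (a : E N → E N → E N) (r : ℝ)
    (w₁ w₂ : E N → ℝ) : ℝ :=
  negDivPairing Ω a w₁ (quotTest r w₁ w₂ w₁) - negDivPairing Ω a w₂ (quotTest r w₁ w₂ w₂)

/-- `w` is locally bounded away from zero in `Ω`: on every compact subset of `Ω` it has a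
positive essential lower bound. -/
def LocallyPositive {N : ℕ} (Ω : Set (E N)) (w : E N → ℝ) : Prop :=
  ∀ K : Set (E N), K ⊆ Ω → IsCompact K → ∃ c : ℝ, 0 < c ∧ ∀ᵐ x ∂(volume.restrict K), c ≤ w x

end DiazSaa

end

/-! The inequality holds pointwise under the integral. Fix `x` and put `B = A(x,·)`, `p = p(x)`, `ξ
= ∇w₁`, `η = ∇w₂`, `α = B(ξ)^{1/p}`, `β = B(η)^{1/p}`, `k = w₂/w₁`. The chain rule gives `∇φ₁ = (1 +
(r-1)k^r) ξ - r k^{r-1} η`, and `-∇φ₂` is the same expression with the roles exchanged. Euler's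
identity gives `a(x,ξ)·ξ = α^p`, and convexity with homogeneity gives the Cauchy–Schwarz bound
`a(x,ξ)·η ≤ α^{p-1} β` (`inner_gradient_le_of_homogeneous`). Young's inequality with exponent `r`
(`cross_term_le`) then cancels every occurrence of `k`, and what is left is `(α^{p-r} - β^{p-r})(α^r
- β^r) ≥ 0` (`pointwise_diazSaa`).

If the integral vanishes, all these inequalities are equalities a.e. Where `p ≠ r` this forces `∇w₁
= ∇w₂`; if `r > 1` it forces `w₂∇w₁ = w₁∇w₂`. Equal gradients everywhere give `w₁ = w₂`, since both
lie in `W_0^{1,1}` (`HasW0Grad.ae_eq_zero`). Proportional gradients say that `log(w₁/w₂)` has zero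
weak gradient; this is meaningful where both functions are locally bounded below, and connectedness
makes the quotient constant (`HasW0Grad.exists_div_ae_eq_const`).

The analytic work is to justify the formula for `∇φᵢ` when `wᵢ` has no positive lower bound near the
boundary. For this `φ₁ = w₁ f(w₂/w₁)` is approximated by smooth functions of `(w₁, w₂)` whose
derivatives are bounded uniformly (`HasW0Grad.mul_comp_div`). Integrability of the pairing follows
from the growth of `a`, which Euler's identity deduces from the bound on its derivative. -/

namespace DiazSaa

/-! ### Convex homogeneous functions -/

section Pointwise

variable {V : Type*} [NormedAddCommGroup V] [InnerProductSpace ℝ V]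

theorem eq_zero_of_homogeneous {B : V → ℝ} {p : ℝ} (hp : 1 < p)
    (hh : ∀ t : ℝ, 0 < t → ∀ ξ, B (t • ξ) = t ^ p * B ξ) : B 0 = 0 := by
  have h := hh 2 two_pos 0
  rw [smul_zero] at h
  have : (1 : ℝ) < 2 ^ p := Real.one_lt_rpow (by norm_num) (by linarith)
  nlinarith

/-- Euler's identity for positively homogeneous functions. -/
theorem fderiv_apply_self_of_homogeneous {B : V → ℝ} {p : ℝ} {ξ : V}
    (hd : DifferentiableAt ℝ B ξ)
    (hh : ∀ t : ℝ, 0 < t → B (t • ξ) = t ^ p * B ξ) :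
    fderiv ℝ B ξ ξ = p * B ξ := by
  have h1 : HasDerivAt (fun t : ℝ => B (t • ξ)) (fderiv ℝ B ξ ξ) 1 := by
    have h : HasFDerivAt B (fderiv ℝ B ξ) ((1 : ℝ) • ξ) := by
      rw [one_smul]; exact hd.hasFDerivAt
    have h' : HasDerivAt (fun t : ℝ => t • ξ) ξ 1 := by
      simpa using (hasDerivAt_id (1 : ℝ)).smul_const ξ
    exact h.comp_hasDerivAt (1 : ℝ) h'
  have h2 : HasDerivAt (fun t : ℝ => B (t • ξ)) (p * B ξ) 1 := by
    have h := (Real.hasDerivAt_rpow_const (x := 1) (p := p) (Or.inl one_ne_zero)).mul_const (B ξ)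
    simp only [Real.one_rpow, mul_one] at h
    refine h.congr_of_eventuallyEq ?_
    filter_upwards [lt_mem_nhds (zero_lt_one' ℝ)] with t ht
    exact hh t ht
  exact h1.unique h2

variable [CompleteSpace V]

/-- First order characterisation of convexity. -/
theorem convexOn_gradient_le {B : V → ℝ} (hc : ConvexOn ℝ univ B) (hd : Differentiable ℝ B)
    (ξ η : V) : B ξ + ⟪gradient B ξ, η - ξ⟫_ℝ ≤ B η := by
  have hl : ConvexOn ℝ univ (B ∘ (AffineMap.lineMap ξ η : ℝ →ᵃ[ℝ] V)) := by
    simpa using hc.comp_affineMap (AffineMap.lineMap ξ η : ℝ →ᵃ[ℝ] V)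
  have hder : HasDerivAt (B ∘ (AffineMap.lineMap ξ η : ℝ →ᵃ[ℝ] V)) (fderiv ℝ B ξ (η - ξ)) 0 := by
    have h1 : HasFDerivAt B (fderiv ℝ B ξ) ((AffineMap.lineMap ξ η : ℝ →ᵃ[ℝ] V) 0) := by
      simpa using (hd ξ).hasFDerivAt
    exact h1.comp_hasDerivAt (0 : ℝ) AffineMap.hasDerivAt_lineMap
  have := hl.le_slope_of_hasDerivAt (mem_univ (0 : ℝ)) (mem_univ (1 : ℝ)) one_pos hder
  rw [slope_def_field] at this
  simp at this
  rw [inner_gradient_left]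
  simp
  linarith

/-- The tangent inequality is taken at the midpoint, where the function lies strictly below the
chord. -/
theorem strictConvexOn_gradient_lt {B : V → ℝ} (hc : StrictConvexOn ℝ univ B)
    (hd : Differentiable ℝ B) {ξ η : V} (h : ξ ≠ η) :
    B ξ + ⟪gradient B ξ, η - ξ⟫_ℝ < B η := by
  have h1 := convexOn_gradient_le hc.convexOn hd ξ ((1 / 2 : ℝ) • ξ + (1 / 2 : ℝ) • η)
  have h2 := hc.2 (mem_univ ξ) (mem_univ η) h (by norm_num : (0 : ℝ) < 1 / 2)
    (by norm_num : (0 : ℝ) < 1 / 2) (by norm_num)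
  have h3 : (1 / 2 : ℝ) • ξ + (1 / 2 : ℝ) • η - ξ = (1 / 2 : ℝ) • (η - ξ) := by module
  rw [h3, inner_smul_right] at h1
  simp only [smul_eq_mul] at h2
  linarith

/-- The gradient of a positively `p`-homogeneous function is positively
`(p - 1)`-homogeneous. -/
theorem gradient_homogeneous {B : V → ℝ} {p : ℝ} (hd : Differentiable ℝ B)
    (hh : ∀ t : ℝ, 0 < t → ∀ ξ, B (t • ξ) = t ^ p * B ξ) {t : ℝ} (ht : 0 < t) (ξ : V) :
    gradient B (t • ξ) = t ^ (p - 1) • gradient B ξ := by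
  refine ext_inner_right ℝ fun v => ?_
  rw [inner_smul_left, inner_gradient_left, inner_gradient_left]
  have h1 : HasFDerivAt (fun η : V => B (t • η))
      ((fderiv ℝ B (t • ξ)).comp (t • ContinuousLinearMap.id ℝ V)) ξ :=
    (hd (t • ξ)).hasFDerivAt.comp ξ ((hasFDerivAt_id ξ).const_smul t)
  have h2 : HasFDerivAt (fun η : V => B (t • η)) (t ^ p • fderiv ℝ B ξ) ξ := by
    have := (hd ξ).hasFDerivAt.const_mul (t ^ p)
    simpa only [hh t ht] using this
  have h3 := congrArg (fun L => L v) (h1.unique h2)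
  simp at h3
  rw [Real.rpow_sub_one ht.ne']
  simp
  field_simp
  linarith

theorem gradient_zero_of_homogeneous {B : V → ℝ} {p : ℝ} (hp : 1 < p)
    (hd : Differentiable ℝ B) (hh : ∀ t : ℝ, 0 < t → ∀ ξ, B (t • ξ) = t ^ p * B ξ) :
    gradient B 0 = 0 := by
  have h := gradient_homogeneous hd hh two_pos 0
  rw [smul_zero] at h
  have h1 : (1 : ℝ) < 2 ^ (p - 1) := Real.one_lt_rpow (by norm_num) (by linarith)
  have h2 : ((2 : ℝ) ^ (p - 1) - 1) • gradient B 0 = 0 := by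
    rw [sub_smul, ← h, one_smul, sub_self]
  exact (smul_eq_zero.1 h2).resolve_left (by linarith)

/-- Value and gradient both vanish at the origin because the degree exceeds `1`, so the tangent
plane there is zero and strict convexity lifts the graph above it. -/
theorem pos_of_strictConvex_homogeneous {B : V → ℝ} {p : ℝ} (hp : 1 < p)
    (hc : StrictConvexOn ℝ univ B) (hd : Differentiable ℝ B)
    (hh : ∀ t : ℝ, 0 < t → ∀ ξ, B (t • ξ) = t ^ p * B ξ) {ξ : V} (hξ : ξ ≠ 0) : 0 < B ξ := by
  have h := strictConvexOn_gradient_lt hc hd (ξ := 0) (η := ξ) hξ.symm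
  rwa [gradient_zero_of_homogeneous hp hd hh, eq_zero_of_homogeneous hp hh, inner_zero_left,
    add_zero] at h

theorem nonneg_of_strictConvex_homogeneous {B : V → ℝ} {p : ℝ} (hp : 1 < p)
    (hc : StrictConvexOn ℝ univ B) (hd : Differentiable ℝ B)
    (hh : ∀ t : ℝ, 0 < t → ∀ ξ, B (t • ξ) = t ^ p * B ξ) (ξ : V) : 0 ≤ B ξ := by
  rcases eq_or_ne ξ 0 with rfl | h
  · rw [eq_zero_of_homogeneous hp hh]
  · exact (pos_of_strictConvex_homogeneous hp hc hd hh h).le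

/-- A Cauchy–Schwarz inequality for the gradient of a strictly convex positively
`p`-homogeneous function, with its case of equality. -/
theorem inner_gradient_le_of_homogeneous {B : V → ℝ} {p : ℝ} (hp : 1 < p)
    (hc : StrictConvexOn ℝ univ B) (hd : Differentiable ℝ B)
    (hh : ∀ t : ℝ, 0 < t → ∀ ξ, B (t • ξ) = t ^ p * B ξ) (ξ η : V) :
    ⟪(1 / p) • gradient B ξ, η⟫_ℝ ≤ (B ξ ^ (1 / p)) ^ (p - 1) * B η ^ (1 / p) ∧
      (⟪(1 / p) • gradient B ξ, η⟫_ℝ = (B ξ ^ (1 / p)) ^ (p - 1) * B η ^ (1 / p) →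
        B η ^ (1 / p) • ξ = B ξ ^ (1 / p) • η) := by
  have hp0 : 0 < p := by linarith
  have hB0 := eq_zero_of_homogeneous hp hh
  have hz : (0 : ℝ) ^ (1 / p) = 0 := Real.zero_rpow (by positivity)
  rcases eq_or_ne ξ 0 with rfl | hξ
  · simp only [gradient_zero_of_homogeneous hp hd hh, hB0, hz, smul_zero, zero_smul,
      inner_zero_left, implies_true, and_true]
    rw [Real.zero_rpow (by linarith), zero_mul]
  rcases eq_or_ne η 0 with rfl | hη
  · simp [hB0, hz, -one_div]
  have hBξ := pos_of_strictConvex_homogeneous hp hc hd hh hξ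
  have hBη := pos_of_strictConvex_homogeneous hp hc hd hh hη
  set α := B ξ ^ (1 / p) with hα
  set β := B η ^ (1 / p) with hβ
  have hα0 : 0 < α := Real.rpow_pos_of_pos hBξ _
  have hβ0 : 0 < β := Real.rpow_pos_of_pos hBη _
  have hαp : α ^ p = B ξ := by rw [hα, ← Real.rpow_mul hBξ.le, one_div_mul_cancel hp0.ne',
    Real.rpow_one]
  have hβp : β ^ p = B η := by rw [hβ, ← Real.rpow_mul hBη.le, one_div_mul_cancel hp0.ne',
    Real.rpow_one]
  -- Rescaling `η` to the level set of `ξ` removes the values of `B` from the tangent inequality and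
  -- leaves a bound on the inner product alone.
  have hBl : B ((α / β) • η) = B ξ := by
    rw [hh _ (by positivity), Real.div_rpow hα0.le hβ0.le, hαp, hβp]
    field_simp
  have hE : ⟪gradient B ξ, ξ⟫_ℝ = p * B ξ := by
    rw [inner_gradient_left]
    exact fderiv_apply_self_of_homogeneous (hd ξ) fun t ht => hh t ht ξ
  have hα1 : α ^ (p - 1) * α = B ξ := by
    rw [← hαp, Real.rpow_sub_one hα0.ne']; field_simp
  have hle := convexOn_gradient_le hc.convexOn hd ξ ((α / β) • η)
  rw [hBl, inner_sub_right, hE, inner_smul_right] at hle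
  rw [inner_smul_left]
  simp only [conj_trivial]
  have key : α / β * ⟪gradient B ξ, η⟫_ℝ ≤ p * (α ^ (p - 1) * α) := by rw [hα1]; linarith
  refine ⟨?_, fun heq => ?_⟩
  · rw [div_mul_eq_mul_div, div_le_iff₀ hβ0] at key
    rw [one_div_mul_eq_div, div_le_iff₀ hp0]
    have : α * ⟪gradient B ξ, η⟫_ℝ ≤ α * (α ^ (p - 1) * β * p) := by linarith
    exact le_of_mul_le_mul_left this hα0
  · by_contra hne
    -- Equality can only occur when `ξ` is the rescaled `η`: otherwise the tangent inequality is
    -- strict.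
    have hne' : ξ ≠ (α / β) • η := by
      intro h
      apply hne
      conv_lhs => rw [h]
      rw [smul_smul]
      congr 1
      field_simp
    have hlt := strictConvexOn_gradient_lt hc hd hne'
    rw [hBl, inner_sub_right, hE, inner_smul_right] at hlt
    have h2 : ⟪gradient B ξ, η⟫_ℝ = p * (α ^ (p - 1) * β) := by
      rw [← heq]; field_simp
    rw [h2] at hlt
    have h3 : α / β * (p * (α ^ (p - 1) * β)) = p * (α ^ (p - 1) * α) := by field_simp
    rw [h3, hα1] at hlt
    linarith

end Pointwise

/-! ### Scalar inequalities of Young type -/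

theorem young_rpow {r c b : ℝ} (hr : 1 < r) (hc : 0 ≤ c) (hb : 0 ≤ b) :
    r * c ^ (r - 1) * b ≤ (r - 1) * c ^ r + b ^ r ∧
      (r * c ^ (r - 1) * b = (r - 1) * c ^ r + b ^ r → c = b) := by
  rcases hc.eq_or_lt with rfl | hc
  · rw [Real.zero_rpow (by linarith), Real.zero_rpow (by linarith)]
    simp only [mul_zero, zero_mul, zero_add]
    exact ⟨by positivity, fun h => ((Real.rpow_eq_zero hb (by linarith)).1 h.symm).symm⟩
  have e1 : c ^ (r - 1) * b = c ^ r * (b / c) := by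
    rw [Real.rpow_sub_one hc.ne']; field_simp
  have e2 : b ^ r = c ^ r * (b / c) ^ r := by
    rw [Real.div_rpow hb hc.le]
    field_simp
  have hcr : 0 < c ^ r := by positivity
  rcases eq_or_ne c b with rfl | hne
  · refine ⟨?_, fun _ => rfl⟩
    rw [mul_assoc, e1, div_self hc.ne']
    linarith
  -- After division by `c ^ r` the claim is Bernoulli's inequality for `b / c = 1 + s`, strict when
  -- `s ≠ 0`.
  have hB := one_add_mul_self_lt_rpow_one_add (s := b / c - 1) (by
    have : 0 ≤ b / c := by positivity
    linarith) (by
      intro h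
      apply hne
      field_simp at h
      linarith) hr
  have hlt : r * c ^ (r - 1) * b < (r - 1) * c ^ r + b ^ r := by
    rw [mul_assoc, e1, e2]
    rw [show 1 + (b / c - 1) = b / c by ring] at hB
    nlinarith [mul_lt_mul_of_pos_left hB hcr]
  exact ⟨hlt.le, fun h => absurd h hlt.ne⟩

theorem young_rpow_le {r c b : ℝ} (hr : 1 ≤ r) (hc : 0 ≤ c) (hb : 0 ≤ b) :
    r * c ^ (r - 1) * b ≤ (r - 1) * c ^ r + b ^ r := by
  rcases hr.eq_or_lt with rfl | hr
  · simp
  · exact (young_rpow hr hc hb).1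

theorem rpow_sub_mul_rpow_sub_nonneg {m n α β : ℝ} (hm : 0 ≤ m) (hn : 0 ≤ n) (hα : 0 ≤ α)
    (hβ : 0 ≤ β) : 0 ≤ (α ^ m - β ^ m) * (α ^ n - β ^ n) := by
  rcases le_total α β with h | h
  · exact mul_nonneg_of_nonpos_of_nonpos
      (sub_nonpos.2 (Real.rpow_le_rpow hα h hm)) (sub_nonpos.2 (Real.rpow_le_rpow hα h hn))
  · exact mul_nonneg (sub_nonneg.2 (Real.rpow_le_rpow hβ h hm))
      (sub_nonneg.2 (Real.rpow_le_rpow hβ h hn))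

theorem eq_of_rpow_sub_mul_rpow_sub_eq_zero {m n α β : ℝ} (hm : 0 < m) (hn : 0 < n) (hα : 0 ≤ α)
    (hβ : 0 ≤ β) (h : (α ^ m - β ^ m) * (α ^ n - β ^ n) = 0) : α = β := by
  rcases mul_eq_zero.1 h with h | h
  · exact (Real.rpow_left_inj hα hβ hm.ne').1 (sub_eq_zero.1 h)
  · exact (Real.rpow_left_inj hα hβ hn.ne').1 (sub_eq_zero.1 h)

/-- Young's inequality in the form used for the cross terms. -/
theorem cross_term_le {p r k α β : ℝ} (hr : 1 ≤ r) (hrp : r ≤ p) (hk : 0 < k)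
    (hα : 0 ≤ α) (hβ : 0 ≤ β) :
    r * k ^ (r - 1) * (α ^ (p - 1) * β) ≤ (r - 1) * k ^ r * α ^ p + α ^ (p - r) * β ^ r ∧
      (r * k ^ (r - 1) * (α ^ (p - 1) * β) = (r - 1) * k ^ r * α ^ p + α ^ (p - r) * β ^ r →
        1 < r → k * α = β ∨ (r < p ∧ α = 0)) := by
  -- Both sides contain the factor `α ^ (p - r)`; the cofactors are compared by Young's inequality
  -- for `k * α` and `β`.
  have e1 : α ^ p = α ^ (p - r) * α ^ r := by
    rw [← Real.rpow_add_of_nonneg hα (by linarith) (by linarith)]; congr 1; ring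
  have e2 : α ^ (p - 1) = α ^ (p - r) * α ^ (r - 1) := by
    rw [← Real.rpow_add_of_nonneg hα (by linarith) (by linarith)]; congr 1; ring
  have hka : 0 ≤ k * α := by positivity
  have hY := young_rpow_le hr hka hβ
  have h0 : 0 ≤ α ^ (p - r) := by positivity
  have eL : r * k ^ (r - 1) * (α ^ (p - 1) * β) = α ^ (p - r) * (r * (k * α) ^ (r - 1) * β) := by
    rw [e2, Real.mul_rpow hk.le hα]; ring
  have eR : (r - 1) * k ^ r * α ^ p + α ^ (p - r) * β ^ r =
      α ^ (p - r) * ((r - 1) * (k * α) ^ r + β ^ r) := by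
    rw [e1, Real.mul_rpow hk.le hα]; ring
  rw [eL, eR]
  refine ⟨mul_le_mul_of_nonneg_left hY h0, fun h hr1 => ?_⟩
  -- The common factor can vanish only if `α = 0` and `p ≠ r`, since `0 ^ 0 = 1`.
  rcases mul_eq_mul_left_iff.1 h with h | h
  · exact Or.inl ((young_rpow hr1 hka hβ).2 h)
  · right
    have := (Real.rpow_eq_zero_iff_of_nonneg hα).1 h
    exact ⟨lt_of_le_of_ne hrp fun h => this.2 (by linarith), this.1⟩

/-! ### The pointwise Diaz–Saa inequality -/

section Pointwise

variable {V : Type*} [NormedAddCommGroup V] [InnerProductSpace ℝ V] [CompleteSpace V]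

/-- The pointwise Diaz–Saa inequality and its case of equality. -/
theorem pointwise_diazSaa {B : V → ℝ} {p r s t : ℝ} (hp : 1 < p) (hr : 1 ≤ r) (hrp : r ≤ p)
    (hc : StrictConvexOn ℝ univ B) (hd : Differentiable ℝ B)
    (hh : ∀ t : ℝ, 0 < t → ∀ ξ, B (t • ξ) = t ^ p * B ξ) (hs : 0 < s) (ht : 0 < t) (ξ η : V) :
    0 ≤ ⟪(1 / p) • gradient B ξ,
          (1 + (r - 1) * (t / s) ^ r) • ξ - (r * (t / s) ^ (r - 1)) • η⟫_ℝ +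
        ⟪(1 / p) • gradient B η,
          (1 + (r - 1) * (s / t) ^ r) • η - (r * (s / t) ^ (r - 1)) • ξ⟫_ℝ ∧
      (⟪(1 / p) • gradient B ξ,
          (1 + (r - 1) * (t / s) ^ r) • ξ - (r * (t / s) ^ (r - 1)) • η⟫_ℝ +
        ⟪(1 / p) • gradient B η,
          (1 + (r - 1) * (s / t) ^ r) • η - (r * (s / t) ^ (r - 1)) • ξ⟫_ℝ = 0 →
        (1 < r → t • ξ = s • η) ∧ (p ≠ r → ξ = η)) := by
  have hp0 : 0 < p := by linarith
  have hEu : ∀ ζ, ⟪(1 / p) • gradient B ζ, ζ⟫_ℝ = (B ζ ^ (1 / p)) ^ p := fun ζ => by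
    rw [inner_smul_left, inner_gradient_left,
      fderiv_apply_self_of_homogeneous (hd ζ) fun t ht => hh t ht ζ,
      ← Real.rpow_mul (nonneg_of_strictConvex_homogeneous hp hc hd hh ζ),
      one_div_mul_cancel hp0.ne', Real.rpow_one]
    simp only [conj_trivial]
    field_simp
  have hζ0 : ∀ ζ, B ζ ^ (1 / p) = 0 → ζ = 0 := fun ζ h => by
    by_contra hne
    exact (Real.rpow_pos_of_pos (pos_of_strictConvex_homogeneous hp hc hd hh hne) _).ne' h
  obtain ⟨c1, c1'⟩ := inner_gradient_le_of_homogeneous hp hc hd hh ξ η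
  obtain ⟨c2, c2'⟩ := inner_gradient_le_of_homogeneous hp hc hd hh η ξ
  have hα : 0 ≤ B ξ ^ (1 / p) :=
    Real.rpow_nonneg (nonneg_of_strictConvex_homogeneous hp hc hd hh ξ) _
  have hβ : 0 ≤ B η ^ (1 / p) :=
    Real.rpow_nonneg (nonneg_of_strictConvex_homogeneous hp hc hd hh η) _
  simp only [inner_sub_right, inner_smul_right, hEu]
  have hξ0 := hζ0 ξ
  have hη0 := hζ0 η
  set α := B ξ ^ (1 / p)
  set β := B η ^ (1 / p)
  set X := ⟪(1 / p) • gradient B ξ, η⟫_ℝ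
  set Y := ⟪(1 / p) • gradient B η, ξ⟫_ℝ
  obtain ⟨y1, y1'⟩ := cross_term_le hr hrp (div_pos ht hs) hα hβ
  obtain ⟨y2, y2'⟩ := cross_term_le hr hrp (div_pos hs ht) hβ hα
  have hk1 : 0 < r * (t / s) ^ (r - 1) := by positivity
  have hk2 : 0 < r * (s / t) ^ (r - 1) := by positivity
  have m1 := mul_le_mul_of_nonneg_left c1 hk1.le
  have m2 := mul_le_mul_of_nonneg_left c2 hk2.le
  have hM := rpow_sub_mul_rpow_sub_nonneg (sub_nonneg.2 hrp) (by linarith : 0 ≤ r) hα hβ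
  have eα : α ^ p = α ^ (p - r) * α ^ r := by
    rw [← Real.rpow_add_of_nonneg hα (by linarith) (by linarith)]; congr 1; ring
  have eβ : β ^ p = β ^ (p - r) * β ^ r := by
    rw [← Real.rpow_add_of_nonneg hβ (by linarith) (by linarith)]; congr 1; ring
  -- This product is exactly what remains after Cauchy–Schwarz and Young are applied to both cross
  -- terms.
  have hM' : (α ^ (p - r) - β ^ (p - r)) * (α ^ r - β ^ r) =
      α ^ p + β ^ p - α ^ (p - r) * β ^ r - β ^ (p - r) * α ^ r := by rw [eα, eβ]; ring
  rw [hM'] at hM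
  refine ⟨by linarith, fun h0 => ?_⟩
  -- A zero sum forces equality in each of the inequalities just added.
  have n1 : X = α ^ (p - 1) * β := mul_left_cancel₀ hk1.ne' (by linarith)
  have n2 : Y = β ^ (p - 1) * α := mul_left_cancel₀ hk2.ne' (by linarith)
  have col := c1' n1
  have z1 := y1' (by linarith)
  have z2 := y2' (by linarith)
  have hzero : α = 0 → β = 0 → ξ = 0 ∧ η = 0 := fun a b => ⟨hξ0 a, hη0 b⟩
  have hab : r < p → α = β := fun h =>
    eq_of_rpow_sub_mul_rpow_sub_eq_zero (sub_pos.2 h) (by linarith : 0 < r) hα hβ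
      (by rw [hM']; linarith)
  refine ⟨fun hr1 => ?_, fun hne => ?_⟩
  · have hX : t / s * α = β := by
      rcases z1 hr1 with h | ⟨h, h'⟩
      · exact h
      · rw [← hab h, h', mul_zero]
    -- For `α = 0` the collinearity relation carries no information, but then `β = 0` and both
    -- vectors are zero.
    rcases hα.eq_or_lt with h | h
    · obtain ⟨h1, h2⟩ := hzero h.symm (by rw [← hX, ← h, mul_zero])
      rw [h1, h2, smul_zero, smul_zero]
    · rw [← hX] at col
      have h3 : (α / s) • (t • ξ) = (α / s) • (s • η) := by
        rw [smul_smul, smul_smul]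
        convert col using 2 <;> field_simp
      exact smul_right_injective V (by positivity : α / s ≠ 0) h3
  · have hab' := hab (lt_of_le_of_ne hrp hne.symm)
    rcases hα.eq_or_lt with h | h
    · obtain ⟨h1, h2⟩ := hzero h.symm (by rw [← hab', ← h])
      rw [h1, h2]
    · rw [← hab'] at col
      exact smul_right_injective V h.ne' col

end Pointwise

variable {N : ℕ} {Ω : Set (E N)}

/-! ### Convergence in `L¹` -/

section Convergence

variable {α F : Type*} [MeasurableSpace α] {μ : Measure α} [NormedAddCommGroup F]

theorem lintegral_enorm_sub_add {f g : α → F} (hf : AEStronglyMeasurable f μ)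
    (hg : AEStronglyMeasurable g μ) (k : α → ENNReal) :
    ∫⁻ x, ‖f x - g x‖ₑ ∂μ + ∫⁻ x, k x ∂μ = ∫⁻ x, (‖f x - g x‖ₑ + k x) ∂μ :=
  (lintegral_add_left' (hf.sub hg).enorm k).symm

theorem lintegral_enorm_sub_le_add {f g h : α → F} (hf : AEStronglyMeasurable f μ)
    (hg : AEStronglyMeasurable g μ) :
    ∫⁻ x, ‖f x - h x‖ₑ ∂μ ≤ ∫⁻ x, ‖f x - g x‖ₑ ∂μ + ∫⁻ x, ‖g x - h x‖ₑ ∂μ := by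
  rw [lintegral_enorm_sub_add hf hg]
  refine lintegral_mono fun x => ?_
  calc ‖f x - h x‖ₑ = ‖(f x - g x) + (g x - h x)‖ₑ := by rw [sub_add_sub_cancel]
    _ ≤ _ := enorm_add_le _ _

theorem exists_seq_tendsto_ae_of_tendsto_lintegral {f : ℕ → α → F} {g : α → F}
    (hf : ∀ n, AEStronglyMeasurable (f n) μ) (hg : AEStronglyMeasurable g μ)
    (h : Tendsto (fun n => ∫⁻ x, ‖f n x - g x‖ₑ ∂μ) atTop (𝓝 0)) :
    ∃ ns : ℕ → ℕ, StrictMono ns ∧ ∀ᵐ x ∂μ, Tendsto (fun n => f (ns n) x) atTop (𝓝 (g x)) := by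
  refine (tendstoInMeasure_of_tendsto_eLpNorm one_ne_zero hf hg ?_).exists_seq_tendsto_ae
  simpa only [eLpNorm_one_eq_lintegral_enorm, Pi.sub_apply] using h

/-- Products of boundedly a.e. convergent scalars and `L¹`-convergent functions converge
in `L¹`. -/
theorem tendsto_lintegral_enorm_smul_sub [NormedSpace ℝ F] {c : ℕ → α → ℝ} {c₀ : α → ℝ}
    {f : ℕ → α → F} {g : α → F} {C : ℝ} (hc : ∀ n, AEStronglyMeasurable (c n) μ)
    (hC : ∀ n, ∀ᵐ x ∂μ, |c n x| ≤ C)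
    (hlim : ∀ᵐ x ∂μ, Tendsto (fun n => c n x) atTop (𝓝 (c₀ x)))
    (hf : ∀ n, AEStronglyMeasurable (f n) μ) (hg : Integrable g μ)
    (h : Tendsto (fun n => ∫⁻ x, ‖f n x - g x‖ₑ ∂μ) atTop (𝓝 0)) :
    Tendsto (fun n => ∫⁻ x, ‖c n x • f n x - c₀ x • g x‖ₑ ∂μ) atTop (𝓝 0) := by
  have hCe : ∀ n, ∀ᵐ x ∂μ, ‖c n x‖ₑ ≤ ENNReal.ofReal C := fun n => by
    filter_upwards [hC n] with x hx
    rw [Real.enorm_eq_ofReal_abs]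
    exact ENNReal.ofReal_le_ofReal hx
  -- The difference is split as `cₙ (fₙ - g) + (cₙ - c₀) g`: the first term is at most `C` times a
  -- null sequence, the second is dominated by `2C|g|`.
  have h1 : Tendsto (fun n => ∫⁻ x, ‖c n x • f n x - c n x • g x‖ₑ ∂μ) atTop (𝓝 0) := by
    have h2 : Tendsto (fun n => ENNReal.ofReal C * ∫⁻ x, ‖f n x - g x‖ₑ ∂μ) atTop (𝓝 0) := by
      simpa using ENNReal.Tendsto.const_mul h (Or.inr ENNReal.ofReal_ne_top)
    refine tendsto_of_tendsto_of_tendsto_of_le_of_le tendsto_const_nhds h2 (fun _ => zero_le)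
      fun n => ?_
    rw [← lintegral_const_mul' _ _ ENNReal.ofReal_ne_top]
    refine lintegral_mono_ae ?_
    filter_upwards [hCe n] with x hx
    rw [← smul_sub, enorm_smul]
    gcongr
  have h3 : Tendsto (fun n => ∫⁻ x, ‖c n x • g x - c₀ x • g x‖ₑ ∂μ) atTop (𝓝 0) := by
    have h4 : Tendsto (fun n => ∫⁻ x, ‖c n x • g x - c₀ x • g x‖ₑ ∂μ) atTop
        (𝓝 (∫⁻ _, 0 ∂μ)) := by
      have hc₀ : AEStronglyMeasurable c₀ μ := aestronglyMeasurable_of_tendsto_ae _ hc hlim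
      refine tendsto_lintegral_of_dominated_convergence'
        (fun x => (ENNReal.ofReal C + ENNReal.ofReal C) * ‖g x‖ₑ)
        (fun n => (((hc n).smul hg.1).sub (hc₀.smul hg.1)).enorm) (fun n => ?_) ?_ ?_
      · filter_upwards [ae_all_iff.2 hCe, hlim] with x hx hl
        rw [← sub_smul, enorm_smul]
        gcongr
        refine (enorm_sub_le).trans (add_le_add (hx n) ?_)
        exact le_of_tendsto hl.enorm (Eventually.of_forall hx)
      · rw [lintegral_const_mul' _ _ (by simp)]
        exact ENNReal.mul_ne_top (by simp) hg.2.ne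
      · filter_upwards [hlim] with x hl
        have := ((hl.smul_const (g x)).sub_const (c₀ x • g x)).enorm
        simpa using this
    simpa using h4
  have h5 := h1.add h3
  rw [add_zero] at h5
  exact tendsto_of_tendsto_of_tendsto_of_le_of_le tendsto_const_nhds h5 (fun _ => zero_le)
    fun n => lintegral_enorm_sub_le_add ((hc n).smul (hf n)) ((hc n).smul hg.1)

end Convergence

/-! ### `W_0^{1,1}` as a closure, and weak gradients -/

/-- `u` belongs to `W_0^{1,1}(Ω)` and `G` is its weak gradient, expressed as `(u, G)` lying in the
`L¹`-closure of the pairs `(φ, ∇φ)`. -/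
structure HasW0Grad (Ω : Set (E N)) (u : E N → ℝ) (G : E N → E N) : Prop where
  integrable : IntegrableOn u Ω
  integrable_grad : IntegrableOn G Ω
  exists_seq : ∃ φ : ℕ → E N → ℝ, (∀ n, IsTestFunction Ω (φ n)) ∧
    Tendsto (fun n => ∫⁻ x in Ω, ‖φ n x - u x‖ₑ) atTop (𝓝 0) ∧
    Tendsto (fun n => ∫⁻ x in Ω, ‖gradient (φ n) x - G x‖ₑ) atTop (𝓝 0)

theorem gradient_apply (f : E N → ℝ) (x : E N) (i : Fin N) :
    gradient f x i = fderiv ℝ f x (EuclideanSpace.single i 1) := by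
  rw [← inner_gradient_left, EuclideanSpace.inner_single_right]
  simp

theorem continuous_gradient {f : E N → ℝ} (hf : ContDiff ℝ ∞ f) : Continuous (gradient f) :=
  (InnerProductSpace.toDual ℝ (E N)).symm.continuous.comp (hf.continuous_fderiv (by simp))

theorem IsTestFunction.hasCompactSupport_gradient {φ : E N → ℝ} (h : IsTestFunction Ω φ) :
    HasCompactSupport (gradient φ) :=
  (h.2.1.fderiv (𝕜 := ℝ)).comp_left (g := (InnerProductSpace.toDual ℝ (E N)).symm) (map_zero _)

theorem IsTestFunction.hasW0Grad {φ : E N → ℝ} (h : IsTestFunction Ω φ) :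
    HasW0Grad Ω φ (gradient φ) where
  integrable := (h.1.continuous.integrable_of_hasCompactSupport h.2.1).integrableOn
  integrable_grad := ((continuous_gradient h.1).integrable_of_hasCompactSupport
    h.hasCompactSupport_gradient).integrableOn
  exists_seq := ⟨fun _ => φ, fun _ => h, by simp, by simp⟩

/-- A closure is closed: a diagonal choice takes a test function within `1/(n+1)` of the `n`-th
pair. -/
theorem HasW0Grad.of_tendsto {u : ℕ → E N → ℝ} {G : ℕ → E N → E N} {v : E N → ℝ}
    {H : E N → E N} (h : ∀ n, HasW0Grad Ω (u n) (G n)) (hv : IntegrableOn v Ω)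
    (hH : IntegrableOn H Ω)
    (hu : Tendsto (fun n => ∫⁻ x in Ω, ‖u n x - v x‖ₑ) atTop (𝓝 0))
    (hG : Tendsto (fun n => ∫⁻ x in Ω, ‖G n x - H x‖ₑ) atTop (𝓝 0)) : HasW0Grad Ω v H := by
  have hex : ∀ n : ℕ, ∃ φ, IsTestFunction Ω φ ∧
      ∫⁻ x in Ω, ‖φ x - u n x‖ₑ ≤ ((n : ENNReal) + 1)⁻¹ ∧
      ∫⁻ x in Ω, ‖gradient φ x - G n x‖ₑ ≤ ((n : ENNReal) + 1)⁻¹ := fun n => by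
    obtain ⟨φ, hφ, h1, h2⟩ := (h n).exists_seq
    have hpos : (0 : ENNReal) < ((n : ENNReal) + 1)⁻¹ := by simp
    obtain ⟨k, hk1, hk2⟩ := ((h1.eventually (ge_mem_nhds hpos)).and
      (h2.eventually (ge_mem_nhds hpos))).exists
    exact ⟨φ k, hφ k, hk1, hk2⟩
  choose φ hφ h1 h2 using hex
  have hlim : Tendsto (fun n : ℕ => ((n : ENNReal) + 1)⁻¹) atTop (𝓝 0) := by
    have := (tendsto_add_atTop_iff_nat 1).2 ENNReal.tendsto_inv_nat_nhds_zero
    simpa using this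
  refine ⟨hv, hH, φ, hφ, ?_, ?_⟩
  · have := hlim.add hu
    rw [add_zero] at this
    refine tendsto_of_tendsto_of_tendsto_of_le_of_le tendsto_const_nhds this (fun _ => zero_le)
      fun n => ?_
    exact (lintegral_enorm_sub_le_add (hφ n).1.continuous.aestronglyMeasurable
      (h n).integrable.1).trans (by gcongr; exact h1 n)
  · have := hlim.add hG
    rw [add_zero] at this
    refine tendsto_of_tendsto_of_tendsto_of_le_of_le tendsto_const_nhds this (fun _ => zero_le)
      fun n => ?_
    exact (lintegral_enorm_sub_le_add (continuous_gradient (hφ n).1).aestronglyMeasurable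
      (h n).integrable_grad.1).trans (by gcongr; exact h2 n)

theorem HasW0Grad.congr_ae {u v : E N → ℝ} {G H : E N → E N} (h : HasW0Grad Ω u G)
    (huv : u =ᵐ[volume.restrict Ω] v) (hGH : G =ᵐ[volume.restrict Ω] H) : HasW0Grad Ω v H := by
  refine HasW0Grad.of_tendsto (fun _ => h) (Integrable.congr h.integrable huv)
    (Integrable.congr h.integrable_grad hGH) ?_ ?_
  · have : ∫⁻ x in Ω, ‖u x - v x‖ₑ = 0 := by
      rw [← lintegral_zero]
      refine lintegral_congr_ae ?_
      filter_upwards [huv] with x hx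
      simp [hx]
    simp [this]
  · have : ∫⁻ x in Ω, ‖G x - H x‖ₑ = 0 := by
      rw [← lintegral_zero]
      refine lintegral_congr_ae ?_
      filter_upwards [hGH] with x hx
      simp [hx]
    simp [this]

/-- The compact support of `φ` removes the boundary term, so `θ` need not vanish near the boundary;
later `θ` is a coordinate function. -/
theorem IsTestFunction.integral_mul_fderiv {φ θ : E N → ℝ} (h : IsTestFunction Ω φ)
    (hθ : ContDiff ℝ ∞ θ) (i : Fin N) :
    ∫ x in Ω, φ x * fderiv ℝ θ x (EuclideanSpace.single i 1) =
      -∫ x in Ω, gradient φ x i * θ x := by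
  have hφ0 : ∀ x, x ∉ Ω → φ x = 0 := fun x hx => image_eq_zero_of_notMem_tsupport
    fun h' => hx (h.2.2 h')
  have hdφ0 : ∀ x, x ∉ Ω → fderiv ℝ φ x = 0 := fun x hx => by
    by_contra hne
    exact hx (h.2.2 (support_fderiv_subset ℝ hne))
  rw [setIntegral_eq_integral_of_forall_compl_eq_zero fun x hx => by rw [hφ0 x hx, zero_mul],
    setIntegral_eq_integral_of_forall_compl_eq_zero fun x hx => by
      rw [gradient_apply, hdφ0 x hx]; simp]
  simp only [gradient_apply]
  have c1 : Continuous fun x => fderiv ℝ φ x (EuclideanSpace.single i 1) :=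
    (h.1.continuous_fderiv (by simp)).clm_apply continuous_const
  have c2 : Continuous fun x => fderiv ℝ θ x (EuclideanSpace.single i 1) :=
    (hθ.continuous_fderiv (by simp)).clm_apply continuous_const
  have s1 : HasCompactSupport fun x => fderiv ℝ φ x (EuclideanSpace.single i 1) :=
    h.2.1.fderiv_apply (𝕜 := ℝ) _
  refine integral_mul_fderiv_eq_neg_fderiv_mul_of_integrable ?_ ?_ ?_
    (fun x _ => (h.1.differentiable (by simp)) x) (fun x _ => (hθ.differentiable (by simp)) x)
  · exact (c1.mul hθ.continuous).integrable_of_hasCompactSupport s1.mul_right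
  · exact (h.1.continuous.mul c2).integrable_of_hasCompactSupport h.2.1.mul_right
  · exact (h.1.continuous.mul hθ.continuous).integrable_of_hasCompactSupport h.2.1.mul_right

theorem exists_forall_mem_abs_le (hΩb : Bornology.IsBounded Ω) {f : E N → ℝ} (hf : Continuous f) :
    ∃ C, ∀ x ∈ Ω, |f x| ≤ C := by
  obtain ⟨C, hC⟩ := hΩb.isCompact_closure.exists_bound_of_continuousOn hf.continuousOn
  exact ⟨C, fun x hx => hC x (subset_closure hx)⟩

/-- Integration of `L¹`-convergent sequences against a continuous function on a bounded set. -/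
theorem tendsto_integral_mul_of_tendsto_lintegral (hΩm : MeasurableSet Ω)
    (hΩb : Bornology.IsBounded Ω) {f : ℕ → E N → ℝ} {g θ : E N → ℝ} (hθ : Continuous θ)
    (hf : ∀ n, IntegrableOn (f n) Ω) (hg : IntegrableOn g Ω)
    (h : Tendsto (fun n => ∫⁻ x in Ω, ‖f n x - g x‖ₑ) atTop (𝓝 0)) :
    Tendsto (fun n => ∫ x in Ω, f n x * θ x) atTop (𝓝 (∫ x in Ω, g x * θ x)) := by
  obtain ⟨C, hC⟩ := exists_forall_mem_abs_le hΩb hθ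
  have hb : ∀ᵐ x ∂(volume.restrict Ω), ‖θ x‖ ≤ C := by
    filter_upwards [ae_restrict_mem hΩm] with x hx using hC x hx
  have hi : ∀ {k : E N → ℝ}, IntegrableOn k Ω → IntegrableOn (fun x => k x * θ x) Ω :=
    fun hk => Integrable.mul_bdd (c := C) hk hθ.aestronglyMeasurable hb
  refine tendsto_integral_of_L1 _ (hi hg).1 (Eventually.of_forall fun n => hi (hf n)) ?_
  have := tendsto_lintegral_enorm_smul_sub (μ := volume.restrict Ω) (c := fun _ => θ) (c₀ := θ)
    (C := C) (fun _ => hθ.aestronglyMeasurable) (fun _ => hb)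
    (Eventually.of_forall fun x => tendsto_const_nhds) (fun n => (hf n).1) hg h
  simpa only [smul_eq_mul, mul_comm] using this

theorem enorm_apply_le (v : E N) (i : Fin N) : ‖v i‖ₑ ≤ ‖v‖ₑ := by
  rw [enorm_le_iff_norm_le]
  exact PiLp.norm_apply_le v i

theorem integrableOn_apply {G : E N → E N} (h : IntegrableOn G Ω) (i : Fin N) :
    IntegrableOn (fun x => G x i) Ω :=
  (EuclideanSpace.proj (𝕜 := ℝ) i).integrable_comp h

/-- Integration by parts for `u ∈ W_0^{1,1}(Ω)` against functions that are smooth up to the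
boundary. -/
theorem HasW0Grad.integral_mul_fderiv (hΩm : MeasurableSet Ω) (hΩb : Bornology.IsBounded Ω)
    {u θ : E N → ℝ} {G : E N → E N} (h : HasW0Grad Ω u G) (hθ : ContDiff ℝ ∞ θ) (i : Fin N) :
    ∫ x in Ω, u x * fderiv ℝ θ x (EuclideanSpace.single i 1) = -∫ x in Ω, G x i * θ x := by
  obtain ⟨φ, hφ, h1, h2⟩ := h.exists_seq
  have c2 : Continuous fun x => fderiv ℝ θ x (EuclideanSpace.single i 1) :=
    (hθ.continuous_fderiv (by simp)).clm_apply continuous_const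
  have l1 := tendsto_integral_mul_of_tendsto_lintegral hΩm hΩb c2
    (fun n => (hφ n).hasW0Grad.integrable) h.integrable h1
  have l2 := tendsto_integral_mul_of_tendsto_lintegral hΩm hΩb hθ.continuous
    (fun n => integrableOn_apply (hφ n).hasW0Grad.integrable_grad i)
    (integrableOn_apply h.integrable_grad i)
    (tendsto_of_tendsto_of_tendsto_of_le_of_le tendsto_const_nhds h2 (fun _ => zero_le)
      fun n => lintegral_mono fun x => enorm_apply_le (gradient (φ n) x - G x) i)
  refine tendsto_nhds_unique l1 (l2.neg.congr fun n => ?_)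
  exact ((hφ n).integral_mul_fderiv hθ i).symm

theorem HasW0Grad.hasWeakGradient (hΩm : MeasurableSet Ω) (hΩb : Bornology.IsBounded Ω)
    {u : E N → ℝ} {G : E N → E N} (h : HasW0Grad Ω u G) : HasWeakGradient Ω u G :=
  ⟨h.integrable.locallyIntegrableOn, h.integrable_grad.locallyIntegrableOn,
    fun _ hφ i => h.integral_mul_fderiv hΩm hΩb hφ.1 i⟩

theorem IsTestFunction.integral_subset {U : Set (E N)} {φ : E N → ℝ}
    (h : IsTestFunction U φ) (hUΩ : U ⊆ Ω) (i : Fin N) (u : E N → ℝ) :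
    ∫ x in Ω, u x * fderiv ℝ φ x (EuclideanSpace.single i 1) =
      ∫ x in U, u x * fderiv ℝ φ x (EuclideanSpace.single i 1) := by
  have hd : ∀ x, x ∉ U → fderiv ℝ φ x = 0 := fun x hx => by
    by_contra hne
    exact hx (h.2.2 (support_fderiv_subset ℝ hne))
  rw [setIntegral_eq_integral_of_forall_compl_eq_zero fun x hx => by
      rw [hd x fun h' => hx (hUΩ h')]; simp,
    setIntegral_eq_integral_of_forall_compl_eq_zero fun x hx => by rw [hd x hx]; simp]

theorem locallyIntegrableOn_apply {G : E N → E N} (h : LocallyIntegrableOn G Ω) (i : Fin N) :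
    LocallyIntegrableOn (fun x => G x i) Ω := fun x hx => by
  obtain ⟨s, hs, hi⟩ := h x hx
  exact ⟨s, hs, integrableOn_apply hi i⟩

/-- Uniqueness of weak gradients. -/
theorem HasWeakGradient.ae_eq (hΩo : IsOpen Ω) {u : E N → ℝ} {G H : E N → E N}
    (hG : HasWeakGradient Ω u G) (hH : HasWeakGradient Ω u H) : G =ᵐ[volume.restrict Ω] H := by
  have hi : ∀ i : Fin N, ∀ᵐ x : E N, x ∈ Ω → G x i - H x i = 0 := fun i => by
    have lG := locallyIntegrableOn_apply hG.2.1 i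
    have lH := locallyIntegrableOn_apply hH.2.1 i
    refine hΩo.ae_eq_zero_of_integral_contDiff_smul_eq_zero (lG.sub lH) fun g hg hgc hgΩ => ?_
    have e1 := hG.2.2 g ⟨hg, hgc, hgΩ⟩ i
    have e2 := hH.2.2 g ⟨hg, hgc, hgΩ⟩ i
    have hg0 : ∀ x, x ∉ Ω → g x = 0 := fun x hx => image_eq_zero_of_notMem_tsupport
      fun h' => hx (hgΩ h')
    have key : ∀ {k : E N → ℝ}, LocallyIntegrableOn k Ω →
        Integrable (fun x => k x * g x) ∧ ∫ x, k x * g x = ∫ x in Ω, k x * g x := fun {k} hk => by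
      refine ⟨?_, (setIntegral_eq_integral_of_forall_compl_eq_zero fun x hx => by
        rw [hg0 x hx, mul_zero]).symm⟩
      have h1 : IntegrableOn k (tsupport g) :=
        hk.integrableOn_compact_subset hgΩ hgc
      have h2 : IntegrableOn (fun x => k x * g x) (tsupport g) :=
        IntegrableOn.mul_continuousOn h1 hg.continuous.continuousOn hgc
      rw [integrableOn_iff_integrable_of_support_subset] at h2
      · exact h2
      · intro x hx
        exact subset_tsupport g (right_ne_zero_of_mul hx)
    obtain ⟨i1, k1⟩ := key lG
    obtain ⟨i2, k2⟩ := key lH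
    simp only [smul_eq_mul, mul_comm (g _), sub_mul]
    rw [integral_sub i1 i2, k1, k2]
    linarith
  rw [EventuallyEq, ae_restrict_iff' hΩo.measurableSet]
  filter_upwards [ae_all_iff.2 hi] with x hx hxΩ
  ext i
  exact sub_eq_zero.1 (hx i hxΩ)

theorem HasWeakGradient.weakGrad {u : E N → ℝ} {G : E N → E N} (h : HasWeakGradient Ω u G) :
    HasWeakGradient Ω u (weakGrad Ω u) := by
  have hex : ∃ G, HasWeakGradient Ω u G := ⟨G, h⟩
  rw [DiazSaa.weakGrad, dif_pos hex]
  exact Classical.choose_spec hex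

/-- This identifies gradients computed along approximating sequences with the arbitrarily chosen
`weakGrad`. -/
theorem HasW0Grad.weakGrad_ae_eq (hΩo : IsOpen Ω) (hΩb : Bornology.IsBounded Ω) {u : E N → ℝ}
    {G : E N → E N} (h : HasW0Grad Ω u G) : weakGrad Ω u =ᵐ[volume.restrict Ω] G :=
  let h' := h.hasWeakGradient hΩo.measurableSet hΩb
  h'.weakGrad.ae_eq hΩo h'

theorem MemLpVar.integrableOn {F : Type*} [NormedAddCommGroup F] {u : E N → F}
    (h : MemLpVar Ω (fun _ => 1) u) : IntegrableOn u Ω :=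
  ⟨h.1, by simpa [HasFiniteIntegral] using h.2⟩

theorem _root_.MeasureTheory.IntegrableOn.memLpVar {F : Type*} [NormedAddCommGroup F]
    {u : E N → F} (h : IntegrableOn u Ω) : MemLpVar Ω (fun _ => 1) u :=
  ⟨h.1, by simpa [HasFiniteIntegral] using h.2⟩

theorem MemW0One.hasW0Grad {u : E N → ℝ} (h : MemW0One Ω u) :
    HasW0Grad Ω u (weakGrad Ω u) := by
  obtain ⟨⟨h1, h2, h3⟩, φ, hφ, hl⟩ := h
  refine ⟨h1.integrableOn, h3.integrableOn, φ, hφ, ?_, ?_⟩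
  · exact tendsto_of_tendsto_of_tendsto_of_le_of_le tendsto_const_nhds hl (fun _ => zero_le)
      fun n => le_self_add
  · exact tendsto_of_tendsto_of_tendsto_of_le_of_le tendsto_const_nhds hl (fun _ => zero_le)
      fun n => le_add_self

theorem HasW0Grad.memW0One (hΩo : IsOpen Ω) (hΩb : Bornology.IsBounded Ω) {u : E N → ℝ}
    {G : E N → E N} (h : HasW0Grad Ω u G) : MemW0One Ω u := by
  have h' : HasW0Grad Ω u (weakGrad Ω u) :=
    h.congr_ae EventuallyEq.rfl (h.weakGrad_ae_eq hΩo hΩb).symm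
  obtain ⟨φ, hφ, l1, l2⟩ := h'.exists_seq
  refine ⟨⟨h'.integrable.memLpVar, h'.hasWeakGradient hΩo.measurableSet hΩb,
    h'.integrable_grad.memLpVar⟩, φ, hφ, ?_⟩
  simpa using l1.add l2

/-! ### Chain rules -/

/-- The chain rule in `W_0^{1,1}(Ω)` for smooth functions of two variables with bounded
derivatives. -/
theorem HasW0Grad.comp₂ {u v : E N → ℝ} {G H : E N → E N} (hu : HasW0Grad Ω u G)
    (hv : HasW0Grad Ω v H) {Φ : ℝ × ℝ → ℝ} (hΦ : ContDiff ℝ ∞ Φ) (hΦ0 : Φ 0 = 0)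
    {Φ₁ Φ₂ : ℝ × ℝ → ℝ} {C : ℝ}
    (hd : ∀ z, HasFDerivAt Φ (Φ₁ z • ContinuousLinearMap.fst ℝ ℝ ℝ +
      Φ₂ z • ContinuousLinearMap.snd ℝ ℝ ℝ) z)
    (h₁ : ∀ z, |Φ₁ z| ≤ C) (h₂ : ∀ z, |Φ₂ z| ≤ C) :
    HasW0Grad Ω (fun x => Φ (u x, v x))
      (fun x => Φ₁ (u x, v x) • G x + Φ₂ (u x, v x) • H x) := by
  have c₁ : Continuous Φ₁ := by
    have : Φ₁ = fun z => fderiv ℝ Φ z (1, 0) := by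
      ext z; rw [(hd z).fderiv]; simp
    rw [this]
    exact (hΦ.continuous_fderiv (by simp)).clm_apply continuous_const
  have c₂ : Continuous Φ₂ := by
    have : Φ₂ = fun z => fderiv ℝ Φ z (0, 1) := by
      ext z; rw [(hd z).fderiv]; simp
    rw [this]
    exact (hΦ.continuous_fderiv (by simp)).clm_apply continuous_const
  have hC : 0 ≤ C := (abs_nonneg _).trans (h₁ 0)
  have hLip : ∀ z w, ‖Φ z - Φ w‖ ≤ 2 * C * ‖z - w‖ := fun z w => by
    refine Convex.norm_image_sub_le_of_norm_hasFDerivWithin_le (s := univ) (f' := fun z =>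
      Φ₁ z • ContinuousLinearMap.fst ℝ ℝ ℝ + Φ₂ z • ContinuousLinearMap.snd ℝ ℝ ℝ)
      (fun x _ => (hd x).hasFDerivWithinAt) (fun x _ => ?_) convex_univ (mem_univ w) (mem_univ z)
    refine (norm_add_le _ _).trans ?_
    rw [norm_smul, norm_smul, two_mul]
    refine add_le_add ?_ ?_
    · exact (mul_le_mul (h₁ x) (ContinuousLinearMap.norm_fst_le ..) (norm_nonneg _) hC).trans
        (by rw [mul_one])
    · exact (mul_le_mul (h₂ x) (ContinuousLinearMap.norm_snd_le ..) (norm_nonneg _) hC).trans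
        (by rw [mul_one])
  have hLip' : ∀ a b c d : ℝ, ‖Φ (a, b) - Φ (c, d)‖ₑ ≤
      ENNReal.ofReal (2 * C) * (‖a - c‖ₑ + ‖b - d‖ₑ) := fun a b c d => by
    have h : ‖Φ (a, b) - Φ (c, d)‖ ≤ 2 * C * (‖a - c‖ + ‖b - d‖) := by
      refine (hLip _ _).trans (mul_le_mul_of_nonneg_left ?_ (by positivity))
      rw [Prod.mk_sub_mk, Prod.norm_mk]
      exact max_le_add_of_nonneg (norm_nonneg _) (norm_nonneg _)
    rw [← ofReal_norm, ← ofReal_norm, ← ofReal_norm,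
      ← ENNReal.ofReal_add (norm_nonneg _) (norm_nonneg _), ← ENNReal.ofReal_mul (by positivity)]
    exact ENNReal.ofReal_le_ofReal h
  obtain ⟨φ', hφ', l1', l2'⟩ := hu.exists_seq
  obtain ⟨ψ', hψ', m1', m2'⟩ := hv.exists_seq
  have hmφ' : ∀ n, AEStronglyMeasurable (φ' n) (volume.restrict Ω) := fun n =>
    (hφ' n).1.continuous.aestronglyMeasurable
  have hmψ' : ∀ n, AEStronglyMeasurable (ψ' n) (volume.restrict Ω) := fun n =>
    (hψ' n).1.continuous.aestronglyMeasurable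
  -- The second subsequence is extracted from the first, so that both components converge a.e. along
  -- the same indices.
  obtain ⟨n₁, hn₁, a1⟩ := exists_seq_tendsto_ae_of_tendsto_lintegral hmφ' hu.integrable.1 l1'
  obtain ⟨n₂, hn₂, a2⟩ := exists_seq_tendsto_ae_of_tendsto_lintegral (fun n => hmψ' (n₁ n))
    hv.integrable.1 (m1'.comp hn₁.tendsto_atTop)
  set φ := fun n => φ' (n₁ (n₂ n)) with hφdef
  set ψ := fun n => ψ' (n₁ (n₂ n)) with hψdef
  have hφ : ∀ n, IsTestFunction Ω (φ n) := fun n => hφ' _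
  have hψ : ∀ n, IsTestFunction Ω (ψ n) := fun n => hψ' _
  have ht := hn₁.tendsto_atTop.comp hn₂.tendsto_atTop
  have l1 : Tendsto (fun n => ∫⁻ x in Ω, ‖φ n x - u x‖ₑ) atTop (𝓝 0) := l1'.comp ht
  have l2 : Tendsto (fun n => ∫⁻ x in Ω, ‖gradient (φ n) x - G x‖ₑ) atTop (𝓝 0) := l2'.comp ht
  have m1 : Tendsto (fun n => ∫⁻ x in Ω, ‖ψ n x - v x‖ₑ) atTop (𝓝 0) := m1'.comp ht
  have m2 : Tendsto (fun n => ∫⁻ x in Ω, ‖gradient (ψ n) x - H x‖ₑ) atTop (𝓝 0) := m2'.comp ht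
  have hlim : ∀ᵐ x ∂(volume.restrict Ω),
      Tendsto (fun n => (φ n x, ψ n x)) atTop (𝓝 (u x, v x)) := by
    filter_upwards [a1, a2] with x hx1 hx2
    exact (hx1.comp hn₂.tendsto_atTop).prodMk_nhds hx2
  have huv : AEStronglyMeasurable (fun x => (u x, v x)) (volume.restrict Ω) :=
    hu.integrable.1.prodMk hv.integrable.1
  have hint : IntegrableOn (fun x => Φ (u x, v x)) Ω := by
    refine Integrable.mono' ((hu.integrable.norm.add hv.integrable.norm).const_mul (2 * C))
      (hΦ.continuous.comp_aestronglyMeasurable huv) (Eventually.of_forall fun x => ?_)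
    have h := hLip (u x, v x) 0
    rw [hΦ0, sub_zero, sub_zero] at h
    refine h.trans (mul_le_mul_of_nonneg_left ?_ (by positivity))
    exact max_le_add_of_nonneg (norm_nonneg _) (norm_nonneg _)
  have hintG : IntegrableOn (fun x => Φ₁ (u x, v x) • G x) Ω :=
    hu.integrable_grad.bdd_smul C (c₁.comp_aestronglyMeasurable huv)
      (Eventually.of_forall fun x => h₁ _)
  have hintH : IntegrableOn (fun x => Φ₂ (u x, v x) • H x) Ω :=
    hv.integrable_grad.bdd_smul C (c₂.comp_aestronglyMeasurable huv)
      (Eventually.of_forall fun x => h₂ _)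
  have hcont : ∀ n, Continuous fun x => (φ n x, ψ n x) := fun n =>
    (hφ n).1.continuous.prodMk (hψ n).1.continuous
  refine ⟨hint, hintG.add hintH, fun n x => Φ (φ n x, ψ n x), fun n => ?_, ?_, ?_⟩
  -- `Φ 0 = 0` keeps the support of the composite inside the union of the two supports, so it is
  -- again a test function.
  · have hsub : tsupport (fun x => Φ (φ n x, ψ n x)) ⊆ tsupport (φ n) ∪ tsupport (ψ n) := by
      refine closure_minimal (fun x hx => ?_)
        ((isClosed_tsupport _).union (isClosed_tsupport _))
      by_contra hne
      rw [mem_union, not_or] at hne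
      apply hx
      simp only [image_eq_zero_of_notMem_tsupport hne.1, image_eq_zero_of_notMem_tsupport hne.2]
      exact hΦ0
    exact ⟨hΦ.comp ((hφ n).1.prodMk (hψ n).1),
      ((hφ n).2.1.isCompact.union (hψ n).2.1.isCompact).of_isClosed_subset
        (isClosed_tsupport _) hsub, hsub.trans (union_subset (hφ n).2.2 (hψ n).2.2)⟩
  · have h := ENNReal.Tendsto.const_mul (a := ENNReal.ofReal (2 * C)) (l1.add m1)
      (Or.inr ENNReal.ofReal_ne_top)
    rw [add_zero, mul_zero] at h
    refine tendsto_of_tendsto_of_tendsto_of_le_of_le tendsto_const_nhds h (fun _ => zero_le)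
      fun n => ?_
    rw [lintegral_enorm_sub_add (hφ n).1.continuous.aestronglyMeasurable hu.integrable.1,
      ← lintegral_const_mul' _ _ ENNReal.ofReal_ne_top]
    exact lintegral_mono fun x => hLip' _ _ _ _
  · have t1 := tendsto_lintegral_enorm_smul_sub (μ := volume.restrict Ω)
      (c := fun n x => Φ₁ (φ n x, ψ n x)) (c₀ := fun x => Φ₁ (u x, v x)) (C := C)
      (fun n => (c₁.comp (hcont n)).aestronglyMeasurable)
      (fun n => Eventually.of_forall fun x => h₁ _)
      (hlim.mono fun x hx => (c₁.tendsto _).comp hx)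
      (fun n => (continuous_gradient (hφ n).1).aestronglyMeasurable) hu.integrable_grad l2
    have t2 := tendsto_lintegral_enorm_smul_sub (μ := volume.restrict Ω)
      (c := fun n x => Φ₂ (φ n x, ψ n x)) (c₀ := fun x => Φ₂ (u x, v x)) (C := C)
      (fun n => (c₂.comp (hcont n)).aestronglyMeasurable)
      (fun n => Eventually.of_forall fun x => h₂ _)
      (hlim.mono fun x hx => (c₂.tendsto _).comp hx)
      (fun n => (continuous_gradient (hψ n).1).aestronglyMeasurable) hv.integrable_grad m2
    have h := t1.add t2
    rw [add_zero] at h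
    refine tendsto_of_tendsto_of_tendsto_of_le_of_le tendsto_const_nhds h (fun _ => zero_le)
      fun n => ?_
    rw [lintegral_enorm_sub_add (f := fun x => Φ₁ (φ n x, ψ n x) • gradient (φ n) x)
      (((c₁.comp (hcont n)).smul (continuous_gradient (hφ n).1)).aestronglyMeasurable) hintG.1]
    refine lintegral_mono fun x => ?_
    have hgr : gradient (fun x => Φ (φ n x, ψ n x)) x =
        Φ₁ (φ n x, ψ n x) • gradient (φ n) x + Φ₂ (φ n x, ψ n x) • gradient (ψ n) x := by
      refine ext_inner_right ℝ fun y => ?_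
      rw [inner_add_left, inner_smul_left, inner_smul_left, inner_gradient_left,
        inner_gradient_left, inner_gradient_left]
      have hD := (hd (φ n x, ψ n x)).comp x
        ((((hφ n).1.differentiable (by simp)) x).hasFDerivAt.prodMk
          (((hψ n).1.differentiable (by simp)) x).hasFDerivAt)
      have hD' := hD.fderiv
      simp only [Function.comp_def] at hD'
      rw [hD']
      simp
    rw [hgr, add_sub_add_comm]
    exact enorm_add_le _ _

/-- The chain rule in `W_0^{1,1}(Ω)` for smooth functions of one variable with bounded
derivative. -/
theorem HasW0Grad.comp {u : E N → ℝ} {G : E N → E N} (hu : HasW0Grad Ω u G) {f : ℝ → ℝ}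
    (hf : ContDiff ℝ ∞ f) (hf0 : f 0 = 0) {C : ℝ} (hC : ∀ s, |deriv f s| ≤ C) :
    HasW0Grad Ω (fun x => f (u x)) (fun x => deriv f (u x) • G x) := by
  have h := hu.comp₂ hu (Φ := fun z => f z.1) (Φ₁ := fun z => deriv f z.1) (Φ₂ := fun _ => 0)
    (C := C) (hf.comp contDiff_fst) hf0 (fun z => ?_) (fun z => hC _)
    (fun _ => by simpa using (abs_nonneg _).trans (hC 0))
  · simpa using h
  · have h1 : HasDerivAt f (deriv f z.1) z.1 :=
      (hf.differentiable (by simp) z.1).hasDerivAt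
    simpa [Function.comp_def] using h1.comp_hasFDerivAt z hasFDerivAt_fst

theorem HasW0Grad.sub {u v : E N → ℝ} {G H : E N → E N} (hu : HasW0Grad Ω u G)
    (hv : HasW0Grad Ω v H) : HasW0Grad Ω (fun x => u x - v x) (fun x => G x - H x) := by
  have h := hu.comp₂ hv (Φ := fun z => z.1 - z.2) (Φ₁ := fun _ => 1) (Φ₂ := fun _ => -1)
    (C := 1) (contDiff_fst.sub contDiff_snd) (by simp) (fun z => ?_) (by simp) (by simp)
  · simpa only [one_smul, neg_smul, ← sub_eq_add_neg] using h
  · have h1 := (hasFDerivAt_fst (𝕜 := ℝ) (E := ℝ) (F := ℝ) (p := z)).fun_sub hasFDerivAt_snd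
    exact h1.congr_fderiv (by ext <;> simp)

/-! ### Functions of a quotient -/

/-- A function that is smooth on `(0, ∞)` agrees on `[a, b] ⊆ (0, ∞)` with a smooth compactly
supported function. -/
theorem exists_contDiff_hasCompactSupport_eventuallyEq {f : ℝ → ℝ}
    (hf : ContDiffOn ℝ ∞ f (Ioi 0)) {a : ℝ} (ha : 0 < a) (b : ℝ) :
    ∃ g : ℝ → ℝ, ContDiff ℝ ∞ g ∧ HasCompactSupport g ∧ ∀ q ∈ Icc a b, g =ᶠ[𝓝 q] f := by
  set B := max a b
  have hB : a ≤ B := le_max_left _ _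
  -- The bump equals `1` on `[a/2, B + a/2]` and is supported in `[a/4, B + 3a/4]`, away from `0`;
  -- `B = max a b` keeps the radii positive even if `b < a`.
  let χ : ContDiffBump ((B + a) / 2 : ℝ) :=
    { rIn := (B + a) / 2 - a / 2
      rOut := (B + a) / 2 - a / 4
      rIn_pos := by linarith
      rIn_lt_rOut := by linarith }
  refine ⟨fun q => χ q * f q, ?_, χ.hasCompactSupport.mul_right, fun q hq => ?_⟩
  · refine contDiff_iff_contDiffAt.2 fun q => ?_
    by_cases hq : q ∈ tsupport fun q => χ q * f q
    swap
    · exact contDiffAt_const.congr_of_eventuallyEq (notMem_tsupport_iff_eventuallyEq.1 hq)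
    have hq' := tsupport_mul_subset_left hq
    rw [χ.tsupport_eq, Metric.mem_closedBall, Real.dist_eq, abs_le] at hq'
    have hq0 : 0 < q := by
      have := hq'.1
      change -((B + a) / 2 - a / 4) ≤ q - (B + a) / 2 at this
      linarith
    exact χ.contDiffAt.mul (hf.contDiffAt (Ioi_mem_nhds hq0))
  · have hq2 : q ≤ B := hq.2.trans (le_max_right _ _)
    have hmem : Metric.ball ((B + a) / 2 : ℝ) χ.rIn ∈ 𝓝 q := by
      refine Metric.isOpen_ball.mem_nhds ?_
      rw [Metric.mem_ball, Real.dist_eq, abs_lt]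
      change -((B + a) / 2 - a / 2) < q - (B + a) / 2 ∧ q - (B + a) / 2 < (B + a) / 2 - a / 2
      constructor <;> linarith [hq.1]
    filter_upwards [hmem] with s hs
    rw [χ.one_of_mem_closedBall (Metric.ball_subset_closedBall hs), one_mul]

theorem hasFDerivAt_of_partial {Φ : ℝ × ℝ → ℝ} {z : ℝ × ℝ} {a b : ℝ}
    (hΦ : DifferentiableAt ℝ Φ z) (h₁ : HasDerivAt (fun s => Φ (s, z.2)) a z.1)
    (h₂ : HasDerivAt (fun t => Φ (z.1, t)) b z.2) :
    HasFDerivAt Φ (a • ContinuousLinearMap.fst ℝ ℝ ℝ + b • ContinuousLinearMap.snd ℝ ℝ ℝ) z := by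
  have hd := hΦ.hasFDerivAt
  have e₁ : fderiv ℝ Φ z (1, 0) = a :=
    (HasFDerivAt.comp_hasDerivAt (f := fun s => (s, z.2)) z.1 hd
      ((hasDerivAt_id z.1).prodMk (hasDerivAt_const z.1 z.2))).unique h₁
  have e₂ : fderiv ℝ Φ z (0, 1) = b :=
    (HasFDerivAt.comp_hasDerivAt (f := fun t => (z.1, t)) z.2 hd
      ((hasDerivAt_const z.2 z.1).prodMk (hasDerivAt_id z.2))).unique h₂
  refine hd.congr_fderiv ?_
  ext
  · simpa using e₁
  · simpa using e₂

/-- The regularised quotient `t s / (s² + ε²)`. -/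
noncomputable def regQuot (ε : ℝ) (z : ℝ × ℝ) : ℝ := z.2 * z.1 / (z.1 ^ 2 + ε ^ 2)

theorem contDiff_regQuot {ε : ℝ} (hε : 0 < ε) : ContDiff ℝ ∞ (regQuot ε) :=
  ContDiff.div (by fun_prop) (by fun_prop) fun z => by positivity

theorem tendsto_regQuot {s t : ℝ} (hs : 0 < s) {ε : ℕ → ℝ} (hε : Tendsto ε atTop (𝓝 0)) :
    Tendsto (fun n => regQuot (ε n) (s, t)) atTop (𝓝 (t / s)) := by
  have h : Tendsto (fun n => t * s / (s ^ 2 + ε n ^ 2)) atTop (𝓝 (t * s / (s ^ 2 + 0 ^ 2))) :=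
    (tendsto_const_nhds.div (tendsto_const_nhds.add (hε.pow 2)) (by positivity))
  rwa [show t * s / (s ^ 2 + 0 ^ 2) = t / s by field_simp; ring] at h

theorem hasDerivAt_regQuot_fst {ε : ℝ} (hε : 0 < ε) (s t : ℝ) :
    HasDerivAt (fun s => regQuot ε (s, t))
      ((t * (s ^ 2 + ε ^ 2) - t * s * (2 * s)) / (s ^ 2 + ε ^ 2) ^ 2) s := by
  have h1 : HasDerivAt (fun s : ℝ => t * s) t s := by
    simpa using (hasDerivAt_id s).const_mul t
  have h2 : HasDerivAt (fun s : ℝ => s ^ 2 + ε ^ 2) (2 * s) s := by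
    simpa using (hasDerivAt_pow 2 s).add_const (ε ^ 2)
  exact h1.div h2 (by positivity)

theorem hasDerivAt_regQuot_snd {ε : ℝ} (s t : ℝ) :
    HasDerivAt (fun t => regQuot ε (s, t)) (s / (s ^ 2 + ε ^ 2)) t := by
  simpa [regQuot] using ((hasDerivAt_id t).mul_const s).div_const (s ^ 2 + ε ^ 2)

/-- The partial derivatives involve only `g(q)`, `q g'(q)`, `g'(q)` and the weight `s²/(s²+ε²) ∈
[0,1]`. For compactly supported `g` they are therefore bounded uniformly in `ε`. -/
theorem hasFDerivAt_mul_comp_regQuot {g : ℝ → ℝ} (hg : ContDiff ℝ ∞ g) {ε : ℝ} (hε : 0 < ε)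
    (z : ℝ × ℝ) :
    HasFDerivAt (fun z : ℝ × ℝ => z.1 * g (regQuot ε z))
      ((g (regQuot ε z) + deriv g (regQuot ε z) * regQuot ε z *
          (1 - 2 * (z.1 ^ 2 / (z.1 ^ 2 + ε ^ 2)))) • ContinuousLinearMap.fst ℝ ℝ ℝ +
        (deriv g (regQuot ε z) * (z.1 ^ 2 / (z.1 ^ 2 + ε ^ 2))) •
          ContinuousLinearMap.snd ℝ ℝ ℝ) z := by
  have hgd : ∀ q, HasDerivAt g (deriv g q) q := fun q =>
    (hg.differentiable (by simp) q).hasDerivAt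
  have hne : z.1 ^ 2 + ε ^ 2 ≠ 0 := by positivity
  refine hasFDerivAt_of_partial
    ((contDiff_fst.mul (hg.comp (contDiff_regQuot hε))).differentiable (by simp) z) ?_ ?_
  · have h := (hasDerivAt_id z.1).mul
      (HasDerivAt.comp z.1 (hgd (regQuot ε (z.1, z.2))) (hasDerivAt_regQuot_fst hε z.1 z.2))
    refine h.congr_deriv ?_
    simp only [regQuot, id, Function.comp]
    field_simp
  · have h := (HasDerivAt.comp z.2 (hgd (regQuot ε (z.1, z.2)))
      (hasDerivAt_regQuot_snd (ε := ε) z.1 z.2)).const_mul z.1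
    refine h.congr_deriv ?_
    simp only [regQuot]
    field_simp

theorem _root_.HasCompactSupport.exists_forall_abs_le {g : ℝ → ℝ} (hg : HasCompactSupport g)
    (hc : Continuous g) : ∃ C, ∀ s, |g s| ≤ C :=
  hg.exists_bound_of_continuous hc

theorem sq_div_sq_add_sq_mem_Icc (s : ℝ) {ε : ℝ} (hε : 0 < ε) :
    s ^ 2 / (s ^ 2 + ε ^ 2) ∈ Icc (0 : ℝ) 1 :=
  ⟨by positivity, (div_le_one (by positivity)).2 (by linarith [sq_nonneg ε])⟩

/-- If `u, v ∈ W_0^{1,1}(Ω)` are positive with `v / u` bounded and bounded away from zero and `f`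
is smooth on `(0, ∞)`, then `u f(v / u) ∈ W_0^{1,1}(Ω)`, and its gradient is the expected one. -/
theorem HasW0Grad.mul_comp_div {u v : E N → ℝ} {G H : E N → E N} (hu : HasW0Grad Ω u G)
    (hv : HasW0Grad Ω v H) (hpos : ∀ᵐ x ∂(volume.restrict Ω), 0 < u x) {a b : ℝ} (ha : 0 < a)
    (hab : ∀ᵐ x ∂(volume.restrict Ω), v x / u x ∈ Icc a b) {f : ℝ → ℝ}
    (hf : ContDiffOn ℝ ∞ f (Ioi 0)) :
    HasW0Grad Ω (fun x => u x * f (v x / u x))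
      (fun x => (f (v x / u x) - v x / u x * deriv f (v x / u x)) • G x +
        deriv f (v x / u x) • H x) := by
  -- The quotient takes values in `[a, b]`, so `f` may be replaced by `g`; agreement on
  -- neighbourhoods carries over to the derivatives.
  obtain ⟨g, hg, hgc, hgf⟩ := exists_contDiff_hasCompactSupport_eventuallyEq hf ha b
  have hg' : Continuous (deriv g) := hg.continuous_deriv (by simp)
  obtain ⟨C₀, hC₀⟩ := hgc.exists_forall_abs_le hg.continuous
  obtain ⟨C₁, hC₁⟩ := hgc.deriv.exists_forall_abs_le hg'
  obtain ⟨C₂, hC₂⟩ : ∃ C₂, ∀ q, |deriv g q * q| ≤ C₂ := (hgc.deriv.mul_right (f' := fun q => q)).exists_forall_abs_le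
    (hg'.mul continuous_id)
  have hC₀0 := (abs_nonneg _).trans (hC₀ 0)
  have hC₁0 := (abs_nonneg _).trans (hC₁ 0)
  have hC₂0 := (abs_nonneg _).trans (hC₂ 0)
  set C := C₀ + C₁ + C₂
  have hq : AEStronglyMeasurable (fun x => v x / u x) (volume.restrict Ω) :=
    (hv.integrable.1.aemeasurable.div hu.integrable.1.aemeasurable).aestronglyMeasurable
  have huv : AEStronglyMeasurable (fun x => (u x, v x)) (volume.restrict Ω) :=
    hu.integrable.1.prodMk hv.integrable.1
  have key : HasW0Grad Ω (fun x => g (v x / u x) * u x)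
      (fun x => (g (v x / u x) - deriv g (v x / u x) * (v x / u x)) • G x +
        deriv g (v x / u x) • H x) := by
    set ε : ℕ → ℝ := fun n => 1 / ((n : ℝ) + 1)
    have hε : ∀ n, 0 < ε n := fun n => by positivity
    have hε0 : Tendsto ε atTop (𝓝 0) := tendsto_one_div_add_atTop_nhds_zero_nat
    have hθ0 : ∀ n (z : ℝ × ℝ), z.1 ^ 2 / (z.1 ^ 2 + ε n ^ 2) ∈ Icc (0 : ℝ) 1 := fun n z =>
      sq_div_sq_add_sq_mem_Icc _ (hε n)
    have b₁ : ∀ n (z : ℝ × ℝ), |g (regQuot (ε n) z) + deriv g (regQuot (ε n) z) *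
        regQuot (ε n) z * (1 - 2 * (z.1 ^ 2 / (z.1 ^ 2 + ε n ^ 2)))| ≤ C := fun n z => by
      obtain ⟨t0, t1⟩ := hθ0 n z
      have h1 : |1 - 2 * (z.1 ^ 2 / (z.1 ^ 2 + ε n ^ 2))| ≤ 1 := by
        rw [abs_le]; constructor <;> linarith
      refine (abs_add_le _ _).trans ?_
      rw [abs_mul]
      have h2 := mul_le_mul (hC₂ (regQuot (ε n) z)) h1 (abs_nonneg _) hC₂0
      linarith [hC₀ (regQuot (ε n) z)]
    have b₂ : ∀ n (z : ℝ × ℝ), |deriv g (regQuot (ε n) z) *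
        (z.1 ^ 2 / (z.1 ^ 2 + ε n ^ 2))| ≤ C := fun n z => by
      obtain ⟨t0, t1⟩ := hθ0 n z
      rw [abs_mul, abs_of_nonneg t0]
      have h2 := mul_le_mul (hC₁ (regQuot (ε n) z)) t1 t0 hC₁0
      linarith
    have cq : ∀ n, Continuous (regQuot (ε n)) := fun n => (contDiff_regQuot (hε n)).continuous
    have cθ : ∀ n, Continuous fun z : ℝ × ℝ => z.1 ^ 2 / (z.1 ^ 2 + ε n ^ 2) := fun n =>
      Continuous.div (by fun_prop) (by fun_prop) fun z => by have := hε n; positivity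
    have c₁ : ∀ n, Continuous fun z : ℝ × ℝ => g (regQuot (ε n) z) + deriv g (regQuot (ε n) z) *
        regQuot (ε n) z * (1 - 2 * (z.1 ^ 2 / (z.1 ^ 2 + ε n ^ 2))) := fun n =>
      (hg.continuous.comp (cq n)).add (((hg'.comp (cq n)).mul (cq n)).mul
        (continuous_const.sub (continuous_const.mul (cθ n))))
    have c₂ : ∀ n, Continuous fun z : ℝ × ℝ => deriv g (regQuot (ε n) z) *
        (z.1 ^ 2 / (z.1 ^ 2 + ε n ^ 2)) := fun n => (hg'.comp (cq n)).mul (cθ n)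
    have hlq : ∀ᵐ x ∂(volume.restrict Ω),
        Tendsto (fun n => regQuot (ε n) (u x, v x)) atTop (𝓝 (v x / u x)) := by
      filter_upwards [hpos] with x hx using tendsto_regQuot hx hε0
    have hlθ : ∀ᵐ x ∂(volume.restrict Ω),
        Tendsto (fun n => (u x) ^ 2 / ((u x) ^ 2 + ε n ^ 2)) atTop (𝓝 1) := by
      filter_upwards [hpos] with x hx
      have h : Tendsto (fun n => (u x) ^ 2 / ((u x) ^ 2 + ε n ^ 2)) atTop
          (𝓝 ((u x) ^ 2 / ((u x) ^ 2 + 0 ^ 2))) :=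
        tendsto_const_nhds.div (tendsto_const_nhds.add (hε0.pow 2)) (by positivity)
      convert h using 2
      field_simp
      ring
    have l₀ : ∀ᵐ x ∂(volume.restrict Ω),
        Tendsto (fun n => g (regQuot (ε n) (u x, v x))) atTop (𝓝 (g (v x / u x))) := by
      filter_upwards [hlq] with x hx using (hg.continuous.tendsto _).comp hx
    have l₂ : ∀ᵐ x ∂(volume.restrict Ω), Tendsto (fun n => deriv g (regQuot (ε n) (u x, v x)) *
        ((u x) ^ 2 / ((u x) ^ 2 + ε n ^ 2))) atTop (𝓝 (deriv g (v x / u x))) := by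
      filter_upwards [hlq, hlθ] with x hx hx'
      simpa using ((hg'.tendsto _).comp hx).mul hx'
    -- The weight tends to `1` where `u > 0`, so `1 - 2 * weight` tends to `-1`, which produces the
    -- minus sign in `g(q) - q g'(q)`.
    have l₁ : ∀ᵐ x ∂(volume.restrict Ω), Tendsto (fun n => g (regQuot (ε n) (u x, v x)) +
        deriv g (regQuot (ε n) (u x, v x)) * regQuot (ε n) (u x, v x) *
          (1 - 2 * ((u x) ^ 2 / ((u x) ^ 2 + ε n ^ 2)))) atTop
        (𝓝 (g (v x / u x) - deriv g (v x / u x) * (v x / u x))) := by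
      filter_upwards [hlq, hlθ, l₀] with x hx hx' hx0
      have hd : Tendsto (fun n => deriv g (regQuot (ε n) (u x, v x))) atTop
          (𝓝 (deriv g (v x / u x))) := (hg'.tendsto _).comp hx
      have h := hx0.add ((hd.mul hx).mul ((hx'.const_mul 2).const_sub 1))
      rwa [show g (v x / u x) + deriv g (v x / u x) * (v x / u x) * (1 - 2 * 1) =
        g (v x / u x) - deriv g (v x / u x) * (v x / u x) by ring] at h
    have t₀ := tendsto_lintegral_enorm_smul_sub (fun n => ((hg.continuous.comp (cq n)
      ).comp_aestronglyMeasurable huv)) (fun n => Eventually.of_forall fun x => hC₀ _) l₀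
      (f := fun _ => u) (fun _ => hu.integrable.1) hu.integrable (by simp)
    have t₁ := tendsto_lintegral_enorm_smul_sub (fun n => ((c₁ n).comp_aestronglyMeasurable huv))
      (fun n => Eventually.of_forall fun x => b₁ n (u x, v x)) l₁
      (f := fun _ => G) (fun _ => hu.integrable_grad.1) hu.integrable_grad (by simp)
    have t₂ := tendsto_lintegral_enorm_smul_sub (fun n => ((c₂ n).comp_aestronglyMeasurable huv))
      (fun n => Eventually.of_forall fun x => b₂ n (u x, v x)) l₂
      (f := fun _ => H) (fun _ => hv.integrable_grad.1) hv.integrable_grad (by simp)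
    have m₁ : AEStronglyMeasurable
        (fun x => g (v x / u x) - deriv g (v x / u x) * (v x / u x)) (volume.restrict Ω) :=
      (hg.continuous.sub (hg'.mul continuous_id)).comp_aestronglyMeasurable hq
    have i₁ : IntegrableOn
        (fun x => (g (v x / u x) - deriv g (v x / u x) * (v x / u x)) • G x) Ω := by
      refine hu.integrable_grad.bdd_smul C m₁ (Eventually.of_forall fun x => ?_)
      refine (norm_sub_le _ _).trans ?_
      have h0 : ‖g (v x / u x)‖ ≤ C₀ := hC₀ _
      have h2 : ‖deriv g (v x / u x) * (v x / u x)‖ ≤ C₂ := hC₂ _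
      linarith
    have i₂ : IntegrableOn (fun x => deriv g (v x / u x) • H x) Ω :=
      hv.integrable_grad.bdd_smul C₁ (hg'.comp_aestronglyMeasurable hq)
        (Eventually.of_forall fun x => hC₁ _)
    refine HasW0Grad.of_tendsto (fun n => hu.comp₂ hv
      (contDiff_fst.mul (hg.comp (contDiff_regQuot (hε n)))) (by simp)
      (hasFDerivAt_mul_comp_regQuot hg (hε n)) (b₁ n) (b₂ n)) ?_ (i₁.add i₂) ?_ ?_
    · exact hu.integrable.bdd_mul (c := C₀) (hg.continuous.comp_aestronglyMeasurable hq)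
        (Eventually.of_forall fun x => hC₀ _)
    · simpa only [smul_eq_mul, mul_comm (u _)] using t₀
    · have h := t₁.add t₂
      rw [add_zero] at h
      refine tendsto_of_tendsto_of_tendsto_of_le_of_le tendsto_const_nhds h (fun _ => zero_le)
        fun n => ?_
      rw [lintegral_enorm_sub_add (f := fun x => (g (regQuot (ε n) (u x, v x)) +
        deriv g (regQuot (ε n) (u x, v x)) * regQuot (ε n) (u x, v x) *
          (1 - 2 * ((u x) ^ 2 / ((u x) ^ 2 + ε n ^ 2)))) • G x) (((c₁ n).comp_aestronglyMeasurable huv).smul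
        hu.integrable_grad.1) i₁.1]
      refine lintegral_mono fun x => ?_
      simp only
      rw [add_sub_add_comm]
      exact enorm_add_le _ _
  refine key.congr_ae ?_ ?_
  · filter_upwards [hab] with x hx
    rw [(hgf _ hx).eq_of_nhds, mul_comm]
  · filter_upwards [hab] with x hx
    rw [(hgf _ hx).eq_of_nhds, (hgf _ hx).deriv_eq, mul_comm (deriv f _)]

/-! ### Functions with vanishing gradient -/

/-- An element of `W_0^{1,1}(Ω)` with zero gradient vanishes. -/
theorem HasW0Grad.ae_eq_zero (hN : 1 ≤ N) (hΩm : MeasurableSet Ω) (hΩb : Bornology.IsBounded Ω)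
    {u : E N → ℝ} (h : HasW0Grad Ω u fun _ => 0) : u =ᵐ[volume.restrict Ω] 0 := by
  have hne : ∀ s : ℝ, 1 + s ^ 2 ≠ 0 := fun s => by positivity
  -- A smooth substitute for `|s|`: nonnegative, zero only at `0`, with derivative bounded by `1`.
  have hf : ContDiff ℝ ∞ fun s : ℝ => √(1 + s ^ 2) - 1 :=
    (ContDiff.sqrt (by fun_prop) hne).sub contDiff_const
  have hder : ∀ s : ℝ, |deriv (fun s : ℝ => √(1 + s ^ 2) - 1) s| ≤ 1 := fun s => by
    have h1 : HasDerivAt (fun s : ℝ => 1 + s ^ 2) (2 * s) s := by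
      simpa using (hasDerivAt_pow 2 s).const_add 1
    rw [((h1.sqrt (hne s)).sub_const 1).deriv, mul_div_mul_left _ _ two_ne_zero, abs_div,
      abs_of_nonneg (Real.sqrt_nonneg _), div_le_one (by positivity)]
    exact Real.abs_le_sqrt (by linarith)
  have h2 := h.comp hf (by simp) hder
  simp only [smul_zero] at h2
  -- Testing against a coordinate function, whose derivative is `1`, shows that `√(1 + u²) - 1` has
  -- integral zero.
  have h3 := h2.integral_mul_fderiv hΩm hΩb
    (EuclideanSpace.proj (𝕜 := ℝ) (⟨0, hN⟩ : Fin N)).contDiff ⟨0, hN⟩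
  have h1 : (EuclideanSpace.proj (𝕜 := ℝ) (⟨0, hN⟩ : Fin N))
      (EuclideanSpace.single ⟨0, hN⟩ 1) = 1 := by simp
  simp only [ContinuousLinearMap.fderiv, PiLp.zero_apply, zero_mul, integral_zero, neg_zero, h1,
    mul_one] at h3
  have hnn : ∀ s : ℝ, 0 ≤ √(1 + s ^ 2) - 1 := fun s => by
    rw [sub_nonneg, Real.one_le_sqrt]
    linarith [sq_nonneg s]
  have h4 := (integral_eq_zero_iff_of_nonneg (fun x => hnn (u x)) h2.integrable).1 h3
  filter_upwards [h4] with x hx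
  have h5 : √(1 + u x ^ 2) = 1 := by
    have : √(1 + u x ^ 2) - 1 = 0 := hx
    linarith
  rw [Real.sqrt_eq_one] at h5
  exact pow_eq_zero_iff two_ne_zero |>.1 (by linarith)

open scoped Convolution in
/-- A function with zero weak gradient on a ball is a.e. constant on the concentric ball of half
the radius. -/
theorem HasWeakGradient.exists_ae_eq_const {f : E N → ℝ} {x₀ : E N} {R : ℝ} (hR : 0 < R)
    (hi : IntegrableOn f (Metric.ball x₀ R))
    (h : HasWeakGradient (Metric.ball x₀ R) f fun _ => 0) :
    ∃ c, ∀ᵐ x ∂(volume.restrict (Metric.ball x₀ (R / 2))), f x = c := by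
  set B := Metric.ball x₀ R
  set g := B.indicator f
  have hBm : MeasurableSet B := Metric.isOpen_ball.measurableSet
  have hg : Integrable g := hi.integrable_indicator hBm
  -- The outer radius is at most `R / 2`, so mollification at points of the half ball sees only `B`;
  -- the ratio `2` of the radii is what a.e. convergence of the mollifications requires.
  let ρ : ℕ → ContDiffBump (0 : E N) := fun n =>
    { rIn := R / 4 / (n + 1)
      rOut := R / 2 / (n + 1)
      rIn_pos := by positivity
      rIn_lt_rOut := by gcongr; norm_num }
  have hρ : ∀ n, (ρ n).rOut = R / 2 / (n + 1) := fun n => rfl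
  have hρ0 : Tendsto (fun n => (ρ n).rOut) atTop (𝓝 0) := by
    have := (tendsto_one_div_add_atTop_nhds_zero_nat (𝕜 := ℝ)).const_mul (R / 2)
    rw [mul_zero] at this
    refine this.congr fun n => ?_
    rw [hρ, mul_one_div]
  have hconv := ContDiffBump.ae_convolution_tendsto_right_of_locallyIntegrable (μ := volume)
    (φ := ρ) (l := atTop) (K := 2) hρ0 (Eventually.of_forall fun n => by
      change R / 2 / (n + 1) ≤ 2 * (R / 4 / (n + 1))
      apply le_of_eq; ring) hg.locallyIntegrable
  set F : ℕ → E N → ℝ := fun n =>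
    (ρ n).normed volume ⋆[ContinuousLinearMap.lsmul ℝ ℝ, volume] g
  have hFd : ∀ n, ∀ x ∈ Metric.ball x₀ (R / 2), HasFDerivAt (F n) (0 : E N →L[ℝ] ℝ) x := by
    intro n x hx
    have hd := (ρ n).hasCompactSupport_normed (μ := volume) |>.hasFDerivAt_convolution_left
      (ContinuousLinearMap.lsmul ℝ ℝ) ((ρ n).contDiff_normed (n := 1)) hg.locallyIntegrable x
    refine hd.congr_fderiv ?_
    refine ContinuousLinearMap.coe_injective
      ((EuclideanSpace.basisFun (Fin N) ℝ).toBasis.ext fun i => ?_)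
    -- The derivative of the convolution falls on the mollifier, and its reflected translate is an
    -- admissible test function on `B`.
    set ψ : E N → ℝ := fun y => (ρ n).normed volume (x - y)
    have hψc : ContDiff ℝ ∞ ψ := (ρ n).contDiff_normed.comp (contDiff_const.sub contDiff_id)
    have hts : tsupport ψ ⊆ Metric.closedBall x (ρ n).rOut := by
      refine closure_minimal (fun y hy => ?_) Metric.isClosed_closedBall
      have : x - y ∈ Function.support ((ρ n).normed volume) := hy
      rw [(ρ n).support_normed_eq, mem_ball_zero_iff] at this
      rw [Metric.mem_closedBall, dist_comm, dist_eq_norm]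
      exact this.le
    have hψ : IsTestFunction B ψ := by
      refine ⟨hψc, (isCompact_closedBall x _).of_isClosed_subset (isClosed_tsupport _) hts,
        hts.trans (Metric.closedBall_subset_ball' ?_)⟩
      have h1 : (ρ n).rOut ≤ R / 2 := by
        rw [hρ]; exact div_le_self (by positivity) (by linarith [n.cast_nonneg (α := ℝ)])
      rw [Metric.mem_ball] at hx
      linarith
    have hz := h.2.2 ψ hψ i
    simp only [PiLp.zero_apply, zero_mul, integral_zero, neg_zero] at hz
    have hψd : ∀ y, fderiv ℝ ψ y (EuclideanSpace.single i 1) =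
        -fderiv ℝ ((ρ n).normed volume) (x - y) (EuclideanSpace.single i 1) := fun y => by
      have h1 : HasFDerivAt (fun y : E N => x - y) (-ContinuousLinearMap.id ℝ (E N)) y := by
        simpa using (hasFDerivAt_id y).const_sub x
      have h2 := (((ρ n).contDiff_normed (n := 1) (μ := volume)).differentiable (by simp)
        (x - y)).hasFDerivAt.comp y h1
      have h3 : fderiv ℝ ψ y = _ := h2.fderiv
      rw [h3]
      simp
    simp only [OrthonormalBasis.coe_toBasis, EuclideanSpace.basisFun_apply,
      ContinuousLinearMap.coe_coe, ContinuousLinearMap.toLinearMap_zero, LinearMap.zero_apply]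
    rw [convolution_eq_swap, ContinuousLinearMap.integral_apply]
    · rw [← neg_eq_zero, ← integral_neg, ← hz,
        ← integral_indicator hBm]
      congr 1
      ext y
      by_cases hy : y ∈ B
      · simp [g, indicator_of_mem hy, hψd, mul_comm]
      · simp [g, indicator_of_notMem hy]
    · have hex := ((ρ n).hasCompactSupport_normed (μ := volume)).fderiv (𝕜 := ℝ)
        |>.convolutionExists_left ((ContinuousLinearMap.lsmul ℝ ℝ).precompL (E N))
          (((ρ n).contDiff_normed (n := 1) (μ := volume)).continuous_fderiv (by simp))
          hg.locallyIntegrable x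
      exact hex.integrable_swap
  have hFc : ∀ n, ∀ x ∈ Metric.ball x₀ (R / 2), F n x = F n x₀ := fun n x hx =>
    Metric.isOpen_ball.is_const_of_fderiv_eq_zero (𝕜 := ℝ)
      (convex_ball x₀ (R / 2)).isPreconnected
      (fun y hy => (hFd n y hy).differentiableAt.differentiableWithinAt)
      (fun y hy => (hFd n y hy).fderiv) hx (Metric.mem_ball_self (by positivity))
  have hlim : ∀ᵐ x ∂(volume.restrict (Metric.ball x₀ (R / 2))),
      Tendsto (fun n => F n x₀) atTop (𝓝 (f x)) := by
    rw [ae_restrict_iff' Metric.isOpen_ball.measurableSet]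
    filter_upwards [hconv] with x hx hxB
    have hgx : g x = f x :=
      indicator_of_mem (Metric.ball_subset_ball (by linarith) hxB) f
    rw [hgx] at hx
    exact hx.congr fun n => hFc n x hxB
  have hne : (ae (volume.restrict (Metric.ball x₀ (R / 2)))).NeBot := by
    rw [ae_neBot, Ne, Measure.restrict_eq_zero]
    exact (Metric.measure_ball_pos _ _ (by positivity)).ne'
  obtain ⟨y, hy⟩ := hlim.exists
  refine ⟨f y, ?_⟩
  filter_upwards [hlim] with x hx using tendsto_nhds_unique hx hy

/-- A function that is locally a.e. constant on a connected open set is a.e. constant there. -/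
theorem exists_ae_eq_const_of_locally {f : E N → ℝ} (hΩ : IsConnected Ω)
    (h : ∀ x ∈ Ω, ∃ c, ∃ V, IsOpen V ∧ x ∈ V ∧ ∀ᵐ y ∂(volume.restrict V), f y = c) :
    ∃ c, ∀ᵐ x ∂(volume.restrict Ω), f x = c := by
  set U : ℝ → Set (E N) := fun c =>
    {x | ∃ V, IsOpen V ∧ x ∈ V ∧ ∀ᵐ y ∂(volume.restrict V), f y = c}
  have hUo : ∀ c, IsOpen (U c) := fun c => by
    rw [isOpen_iff_forall_mem_open]
    rintro x ⟨V, hV, hx, hc⟩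
    exact ⟨V, fun y hy => ⟨V, hV, hy, hc⟩, hV, hx⟩
  have hUd : ∀ c d, c ≠ d → Disjoint (U c) (U d) := fun c d hcd => by
    rw [Set.disjoint_left]
    rintro x ⟨V, hV, hx, hc⟩ ⟨W, hW, hx', hd⟩
    have h1 := ae_mono (Measure.restrict_mono_set volume (inter_subset_left (s := V) (t := W))) hc
    have h2 := ae_mono (Measure.restrict_mono_set volume (inter_subset_right (s := V) (t := W))) hd
    have hne : (ae (volume.restrict (V ∩ W))).NeBot := by
      rw [ae_neBot, Ne, Measure.restrict_eq_zero]
      exact ((hV.inter hW).measure_pos volume ⟨x, hx, hx'⟩).ne'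
    obtain ⟨y, hy1, hy2⟩ := (Eventually.and h1 h2).exists
    exact hcd (hy1.symm.trans hy2)
  obtain ⟨x₀, hx₀⟩ := hΩ.nonempty
  obtain ⟨c, hc⟩ := h x₀ hx₀
  -- The sets `U d` are open and disjoint for distinct `d`, so connectedness leaves a single value.
  have hsub : Ω ⊆ U c := by
    refine IsPreconnected.subset_left_of_subset_union (v := ⋃ d ∈ {d | d ≠ c}, U d) (hUo c)
      (isOpen_biUnion fun d _ => hUo d) ?_ ?_ ⟨x₀, hx₀, hc⟩ hΩ.isPreconnected
    · exact disjoint_iUnion₂_right.2 fun d hd => hUd c d (Ne.symm hd)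
    · intro x hx
      obtain ⟨d, hd⟩ := h x hx
      rcases eq_or_ne d c with rfl | hne
      · exact Or.inl hd
      · exact Or.inr (mem_biUnion (t := U) (show d ∈ {d | d ≠ c} from hne) hd)
  refine ⟨c, ?_⟩
  refine ae_restrict_of_ae_restrict_of_subset hsub ?_
  rw [ae_restrict_iff' (hUo c).measurableSet, ae_iff]
  refine measure_null_of_locally_null _ fun x hx => ?_
  simp only [Classical.not_imp, mem_ofPred_eq] at hx
  obtain ⟨V, hV, hxV, hVc⟩ := hx.1
  rw [ae_restrict_iff' hV.measurableSet, ae_iff] at hVc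
  refine ⟨_, ?_, hVc⟩
  filter_upwards [self_mem_nhdsWithin, mem_nhdsWithin_of_mem_nhds (hV.mem_nhds hxV)] with y hy hyV
  simp only [Classical.not_imp] at hy ⊢
  exact ⟨hyV, hy.2⟩

/-- A smooth function with bounded derivative that vanishes at `0` and agrees with the logarithm
away from `0`. -/
theorem exists_contDiff_eventuallyEq_log {δ : ℝ} (hδ : 0 < δ) :
    ∃ g : ℝ → ℝ, ContDiff ℝ ∞ g ∧ g 0 = 0 ∧ (∃ C, ∀ s, |deriv g s| ≤ C) ∧
      ∀ s, δ ≤ s → g =ᶠ[𝓝 s] Real.log := by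
  -- The transition factor is `0` for `s ≤ δ/2` and `1` for `s ≥ 3δ/4`, which hides the values of
  -- `Real.log` at nonpositive arguments.
  set g : ℝ → ℝ := fun s => Real.smoothTransition (4 * s / δ - 2) * Real.log s
  have h0 : ∀ s ≤ 0, g =ᶠ[𝓝 s] fun _ => 0 := fun s hs => by
    filter_upwards [Iio_mem_nhds (lt_of_le_of_lt hs (by positivity : 0 < δ / 2))] with t ht
    rw [mem_Iio] at ht
    have : Real.smoothTransition (4 * t / δ - 2) = 0 := by
      apply Real.smoothTransition.zero_of_nonpos
      rw [sub_nonpos, div_le_iff₀ hδ]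
      linarith
    simp [g, this]
  have h1 : ∀ s, δ ≤ s → g =ᶠ[𝓝 s] Real.log := fun s hs => by
    filter_upwards [Ioi_mem_nhds (lt_of_lt_of_le (by linarith : 3 * δ / 4 < δ) hs)] with t ht
    rw [mem_Ioi] at ht
    have : Real.smoothTransition (4 * t / δ - 2) = 1 := by
      apply Real.smoothTransition.one_of_one_le
      rw [le_sub_iff_add_le, le_div_iff₀ hδ]
      linarith
    simp [g, this]
  have hg : ContDiff ℝ ∞ g := by
    refine contDiff_iff_contDiffAt.2 fun s => ?_
    rcases le_or_gt s 0 with hs | hs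
    · exact contDiffAt_const.congr_of_eventuallyEq (h0 s hs)
    · exact (Real.smoothTransition.contDiff.comp (by fun_prop)).contDiffAt.mul
        (Real.contDiffAt_log.2 hs.ne')
  refine ⟨g, hg, (h0 0 le_rfl).eq_of_nhds, ?_, h1⟩
  obtain ⟨C, hC⟩ := (isCompact_Icc (a := (0 : ℝ)) (b := δ)).exists_bound_of_continuousOn
    (hg.continuous_deriv (by simp)).continuousOn
  refine ⟨max C (1 / δ), fun s => ?_⟩
  rcases le_or_gt s 0 with hs | hs
  · rw [(h0 s hs).deriv_eq, deriv_const, abs_zero]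
    exact le_max_of_le_right (by positivity)
  rcases le_or_gt s δ with hs' | hs'
  · exact le_max_of_le_left (hC s ⟨hs.le, hs'⟩)
  · rw [(h1 s hs'.le).deriv_eq, Real.deriv_log, abs_of_pos (by positivity)]
    refine le_max_of_le_right ?_
    rw [← one_div]
    gcongr

/-- If `∇u / u = ∇v / v` for `u, v ∈ W_0^{1,1}(Ω)` that are locally bounded away from zero, then
`u / v` is constant. -/
theorem HasW0Grad.exists_div_ae_eq_const (hΩo : IsOpen Ω) (hΩc : IsConnected Ω)
    (hΩb : Bornology.IsBounded Ω) {u v : E N → ℝ} {G H : E N → E N} (hu : HasW0Grad Ω u G)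
    (hv : HasW0Grad Ω v H) (hup : LocallyPositive Ω u) (hvp : LocallyPositive Ω v)
    (h : ∀ᵐ x ∂(volume.restrict Ω), v x • G x = u x • H x) :
    ∃ c, ∀ᵐ x ∂(volume.restrict Ω), u x / v x = c := by
  refine exists_ae_eq_const_of_locally hΩc fun x₀ hx₀ => ?_
  obtain ⟨R, hR, hRΩ⟩ := Metric.nhds_basis_closedBall.mem_iff.1 (hΩo.mem_nhds hx₀)
  obtain ⟨c₁, hc₁, h₁⟩ := hup _ hRΩ (isCompact_closedBall _ _)
  obtain ⟨c₂, hc₂, h₂⟩ := hvp _ hRΩ (isCompact_closedBall _ _)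
  have hBΩ : Metric.ball x₀ R ⊆ Ω := Metric.ball_subset_closedBall.trans hRΩ
  obtain ⟨g, hg, hg0, ⟨C, hC⟩, hgl⟩ := exists_contDiff_eventuallyEq_log (lt_min hc₁ hc₂)
  -- Truncating the logarithm below both lower bounds gives an element of `W_0^{1,1}(Ω)` that equals
  -- `log (u / v)` on the ball.
  have hw := (hu.comp hg hg0 hC).sub (hv.comp hg hg0 hC)
  have hae : ∀ᵐ x ∂(volume.restrict (Metric.ball x₀ R)),
      (g (u x) - g (v x) = Real.log (u x / v x) ∧ 0 < u x / v x) ∧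
        deriv g (u x) • G x - deriv g (v x) • H x = 0 := by
    filter_upwards [ae_restrict_of_ae_restrict_of_subset Metric.ball_subset_closedBall h₁,
      ae_restrict_of_ae_restrict_of_subset Metric.ball_subset_closedBall h₂,
      ae_restrict_of_ae_restrict_of_subset hBΩ h] with x hx1 hx2 hx
    have e1 := hgl (u x) ((min_le_left _ _).trans hx1)
    have e2 := hgl (v x) ((min_le_right _ _).trans hx2)
    have p1 : 0 < u x := hc₁.trans_le hx1
    have p2 : 0 < v x := hc₂.trans_le hx2
    refine ⟨⟨?_, by positivity⟩, ?_⟩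
    · rw [e1.eq_of_nhds, e2.eq_of_nhds, Real.log_div p1.ne' p2.ne']
    · rw [e1.deriv_eq, e2.deriv_eq, Real.deriv_log, Real.deriv_log, sub_eq_zero]
      have h3 := congrArg (fun z => ((u x)⁻¹ * (v x)⁻¹) • z) hx
      simp only [smul_smul] at h3
      rw [inv_mul_cancel_right₀ p2.ne', mul_right_comm, inv_mul_cancel₀ p1.ne', one_mul] at h3
      exact h3
  have hint := hw.integrable.mono_set hBΩ
  have hweak : HasWeakGradient (Metric.ball x₀ R) (fun x => g (u x) - g (v x)) fun _ => 0 := by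
    refine ⟨hint.locallyIntegrableOn, integrableOn_zero.locallyIntegrableOn, fun φ hφ i => ?_⟩
    have hφΩ : IsTestFunction Ω φ := ⟨hφ.1, hφ.2.1, hφ.2.2.trans hBΩ⟩
    -- Integration by parts is done on `Ω`; the gradient is known to vanish only on the ball, but
    -- `φ` vanishes outside it.
    rw [← hφ.integral_subset hBΩ, hw.integral_mul_fderiv hΩo.measurableSet hΩb hφ.1 i]
    simp only [PiLp.zero_apply, zero_mul, integral_zero, neg_zero, neg_eq_zero]
    refine integral_eq_zero_of_ae ?_
    rw [ae_restrict_iff' Metric.isOpen_ball.measurableSet] at hae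
    filter_upwards [ae_restrict_of_ae hae] with x hx
    by_cases hxB : x ∈ Metric.ball x₀ R
    · rw [(hx hxB).2]; simp
    · have : φ x = 0 := image_eq_zero_of_notMem_tsupport fun h' => hxB (hφ.2.2 h')
      simp [this]
  obtain ⟨c, hc⟩ := hweak.exists_ae_eq_const hR hint
  refine ⟨Real.exp c, Metric.ball x₀ (R / 2), Metric.isOpen_ball,
    Metric.mem_ball_self (by positivity), ?_⟩
  filter_upwards [hc, ae_restrict_of_ae_restrict_of_subset
    (Metric.ball_subset_ball (by linarith)) hae] with x hx hx'
  rw [← hx, hx'.1.1, Real.exp_log hx'.1.2]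

variable {p : E N → ℝ}

/-! ### Variable exponent Lebesgue spaces -/

section VariableExponent

variable {F F₁ F₂ : Type*} [NormedAddCommGroup F] [NormedAddCommGroup F₁] [NormedAddCommGroup F₂]

theorem memLpVar_iff_integrable (hΩm : MeasurableSet Ω) (hpm : AEMeasurable p (volume.restrict Ω))
    (hp0 : ∀ x ∈ Ω, 0 ≤ p x) {u : E N → F} :
    MemLpVar Ω p u ↔ AEStronglyMeasurable u (volume.restrict Ω) ∧
      IntegrableOn (fun x => ‖u x‖ ^ p x) Ω := by
  refine and_congr_right fun hu => ?_
  have hm : AEStronglyMeasurable (fun x => ‖u x‖ ^ p x) (volume.restrict Ω) :=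
    (hu.norm.aemeasurable.pow hpm).aestronglyMeasurable
  have he : ∫⁻ x in Ω, ‖u x‖ₑ ^ p x = ∫⁻ x in Ω, ‖‖u x‖ ^ p x‖ₑ := by
    refine lintegral_congr_ae ?_
    filter_upwards [ae_restrict_mem hΩm] with x hx
    rw [Real.enorm_eq_ofReal (by positivity), ← ofReal_norm,
      ENNReal.ofReal_rpow_of_nonneg (norm_nonneg _) (hp0 x hx)]
  rw [he]
  exact ⟨fun h => ⟨hm, h⟩, fun h => h.2⟩

/-- The base `max 1 (2 * C)` is at least `1`, so its exponent can be raised to `P`; the constant is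
then independent of the point at which `q = p x` is taken. -/
theorem rpow_le_of_le_mul_add {a b c C P q : ℝ} (ha : 0 ≤ a) (hb : 0 ≤ b) (hc : 0 ≤ c)
    (hq : 0 ≤ q) (hqP : q ≤ P) (h : c ≤ C * (a + b)) :
    c ^ q ≤ max 1 (2 * C) ^ P * (a ^ q + b ^ q) := by
  have hK : 1 ≤ max 1 (2 * C) := le_max_left _ _
  have h1 : c ≤ max 1 (2 * C) * max a b := by
    refine h.trans ?_
    have h2 : a + b ≤ 2 * max a b := by linarith [le_max_left a b, le_max_right a b]
    have h3 : 0 ≤ max a b := le_max_of_le_left ha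
    rcases le_total 0 C with hC | hC
    · calc C * (a + b) ≤ C * (2 * max a b) := by gcongr
        _ = 2 * C * max a b := by ring
        _ ≤ _ := by gcongr; exact le_max_right _ _
    · have : C * (a + b) ≤ 0 := mul_nonpos_of_nonpos_of_nonneg hC (by positivity)
      exact this.trans (by positivity)
  have h4 : (max a b) ^ q ≤ a ^ q + b ^ q := by
    rcases le_total a b with hab | hab
    · rw [max_eq_right hab]; linarith [Real.rpow_nonneg ha q]
    · rw [max_eq_left hab]; linarith [Real.rpow_nonneg hb q]
  calc c ^ q ≤ (max 1 (2 * C) * max a b) ^ q := by gcongr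
    _ = max 1 (2 * C) ^ q * max a b ^ q :=
      Real.mul_rpow (by positivity) (le_max_of_le_left ha)
    _ ≤ _ := mul_le_mul (Real.rpow_le_rpow_of_exponent_le hK hqP) h4
        (Real.rpow_nonneg (le_max_of_le_left ha) _) (by positivity)

/-- Domination in the variable exponent Lebesgue space. -/
theorem MemLpVar.of_le (hΩm : MeasurableSet Ω) (hpm : AEMeasurable p (volume.restrict Ω))
    (hp0 : ∀ x ∈ Ω, 0 ≤ p x) {P : ℝ} (hP : ∀ x ∈ Ω, p x ≤ P) {u : E N → F} {v : E N → F₁}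
    {w : E N → F₂} (hv : MemLpVar Ω p v) (hw : MemLpVar Ω p w)
    (hu : AEStronglyMeasurable u (volume.restrict Ω)) {C : ℝ}
    (h : ∀ᵐ x ∂(volume.restrict Ω), ‖u x‖ ≤ C * (‖v x‖ + ‖w x‖)) : MemLpVar Ω p u := by
  rw [memLpVar_iff_integrable hΩm hpm hp0] at *
  refine ⟨hu, Integrable.mono' ((hv.2.add hw.2).const_mul (max 1 (2 * C) ^ P))
    (hu.norm.aemeasurable.pow hpm).aestronglyMeasurable ?_⟩
  filter_upwards [ae_restrict_mem hΩm, h] with x hx hx'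
  rw [Real.norm_of_nonneg (by positivity)]
  exact rpow_le_of_le_mul_add (norm_nonneg _) (norm_nonneg _) (norm_nonneg _) (hp0 x hx)
    (hP x hx) hx'

theorem MemLpVar.congr_ae {u v : E N → F} (h : MemLpVar Ω p u)
    (huv : u =ᵐ[volume.restrict Ω] v) : MemLpVar Ω p v := by
  refine ⟨h.1.congr huv, ?_⟩
  have he : ∫⁻ x in Ω, ‖u x‖ₑ ^ p x = ∫⁻ x in Ω, ‖v x‖ₑ ^ p x :=
    lintegral_congr_ae (huv.mono fun x hx => by simp only [hx])
  exact he ▸ h.2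

end VariableExponent

/-! ### Growth and integrability of the flux -/

theorem sum_smul_single (v : E N) : ∑ i, v i • EuclideanSpace.single i (1 : ℝ) = v := by
  have := (EuclideanSpace.basisFun (Fin N) ℝ).sum_repr v
  simpa using this

theorem norm_le_sum_abs (v : E N) : ‖v‖ ≤ ∑ i, |v i| := by
  conv_lhs => rw [← sum_smul_single v]
  refine (norm_sum_le _ _).trans (Finset.sum_le_sum fun i _ => ?_)
  rw [norm_smul]
  simp

theorem abs_apply_le_sum (L : E N →L[ℝ] ℝ) (v : E N) :
    |L v| ≤ (∑ j, |L (EuclideanSpace.single j 1)|) * ‖v‖ := by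
  conv_lhs => rw [← sum_smul_single v]
  rw [map_sum, Finset.sum_mul]
  refine (Finset.abs_sum_le_sum_abs _ _).trans (Finset.sum_le_sum fun i _ => ?_)
  rw [map_smul, smul_eq_mul, abs_mul, mul_comm]
  gcongr
  exact PiLp.norm_apply_le v i

/-- A positively homogeneous flux of positive degree whose derivative has the natural growth has
itself the natural growth. -/
theorem norm_le_of_homogeneous_of_deriv_bound {a : E N → E N} {q Λ : ℝ} (hq : 0 < q) {ξ : E N}
    (hξ : ξ ≠ 0) (hd : DifferentiableAt ℝ a ξ)
    (hh : ∀ t : ℝ, 0 < t → a (t • ξ) = t ^ q • a ξ)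
    (hb : ∑ i : Fin N, ∑ j : Fin N,
      |fderiv ℝ (fun η : E N => a η i) ξ (EuclideanSpace.single j 1)| ≤ Λ * ‖ξ‖ ^ (q - 1)) :
    ‖a ξ‖ ≤ Λ / q * ‖ξ‖ ^ q := by
  have hξ' : 0 < ‖ξ‖ := norm_pos_iff.2 hξ
  have hi : ∀ i : Fin N, q * |a ξ i| ≤
      (∑ j : Fin N, |fderiv ℝ (fun η : E N => a η i) ξ (EuclideanSpace.single j 1)|) * ‖ξ‖ :=
    fun i => by
      have hdi : DifferentiableAt ℝ (fun η : E N => a η i) ξ :=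
        ((EuclideanSpace.proj (𝕜 := ℝ) i).differentiableAt).comp ξ hd
      -- Euler's identity of degree `q` recovers each component of `a` from its derivative in the
      -- direction `ξ`.
      have hE := fderiv_apply_self_of_homogeneous hdi (p := q) fun t ht => by
        rw [hh t ht]; rfl
      have h := abs_apply_le_sum (fderiv ℝ (fun η : E N => a η i) ξ) ξ
      rwa [hE, abs_mul, abs_of_pos hq] at h
  have h1 : q * ‖a ξ‖ ≤ Λ * ‖ξ‖ ^ (q - 1) * ‖ξ‖ := by
    calc q * ‖a ξ‖ ≤ q * ∑ i, |a ξ i| := by gcongr; exact norm_le_sum_abs _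
      _ = ∑ i, q * |a ξ i| := Finset.mul_sum _ _ _
      _ ≤ ∑ i : Fin N, (∑ j : Fin N,
          |fderiv ℝ (fun η : E N => a η i) ξ (EuclideanSpace.single j 1)|) * ‖ξ‖ :=
        Finset.sum_le_sum fun i _ => hi i
      _ = (∑ i : Fin N, ∑ j : Fin N,
          |fderiv ℝ (fun η : E N => a η i) ξ (EuclideanSpace.single j 1)|) * ‖ξ‖ :=
        (Finset.sum_mul _ _ _).symm
      _ ≤ _ := by gcongr
  rw [mul_assoc, ← Real.rpow_add_one hξ'.ne', sub_add_cancel] at h1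
  rw [div_mul_eq_mul_div, le_div_iff₀ hq]
  linarith

section Flux

variable {A : E N → E N → ℝ} {Λ : ℝ}

theorem flux_zero (hA : IsAdmissible Ω p A) {x : E N} (hx : x ∈ Ω) (hp1 : 1 < p x)
    (hh : ∀ t : ℝ, 0 < t → ∀ ξ : E N, A x (t • ξ) = t ^ p x * A x ξ) : flux p A x 0 = 0 := by
  rw [flux, gradient_zero_of_homogeneous hp1 (hA.differentiable x hx) hh, smul_zero]

theorem norm_flux_le (hΩo : IsOpen Ω) (hA : IsAdmissible Ω p A)
    (ha : HasDerivBound Ω p (flux p A) Λ) {x : E N} (hx : x ∈ Ω) (hp1 : 1 < p x)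
    (hh : ∀ t : ℝ, 0 < t → ∀ ξ : E N, A x (t • ξ) = t ^ p x * A x ξ) (ξ : E N) :
    ‖flux p A x ξ‖ ≤ Λ / (p x - 1) * ‖ξ‖ ^ (p x - 1) := by
  rcases eq_or_ne ξ 0 with rfl | hξ
  · rw [flux_zero hA hx hp1 hh, norm_zero, Real.zero_rpow (by linarith), mul_zero]
  refine norm_le_of_homogeneous_of_deriv_bound (by linarith) hξ ?_ (fun t ht => ?_) ?_
  · have hS : IsOpen (Ω ×ˢ ({0}ᶜ : Set (E N))) := hΩo.prod isOpen_compl_singleton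
    have h1 : DifferentiableAt ℝ (fun z : E N × E N => flux p A z.1 z.2) (x, ξ) :=
      (ha.contDiffOn.contDiffAt (hS.mem_nhds (mk_mem_prod hx
        (mem_compl_singleton_iff.2 hξ)))).differentiableAt (by simp)
    exact DifferentiableAt.comp ξ (f := fun η : E N => (x, η)) h1
      ((differentiableAt_const x).prodMk differentiableAt_id)
  · rw [flux, gradient_homogeneous (hA.differentiable x hx) hh ht, smul_comm]
    rfl
  · rw [sub_sub, one_add_one_eq_two]
    exact ha.bound x hx ξ hξ

/-- Joint continuity of the flux is used only off `ξ = 0`; extension by zero is Borel and agrees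
with the flux there, which vanishes at `ξ = 0` for a.e. `x`. -/
theorem aestronglyMeasurable_flux (hΩo : IsOpen Ω) (hp1 : ∀ x ∈ Ω, 1 < p x)
    (hA : IsAdmissible Ω p A) (ha : HasDerivBound Ω p (flux p A) Λ) {G : E N → E N}
    (hG : AEStronglyMeasurable G (volume.restrict Ω)) :
    AEStronglyMeasurable (fun x => flux p A x (G x)) (volume.restrict Ω) := by
  set S : Set (E N × E N) := Ω ×ˢ {0}ᶜ
  have hS : MeasurableSet S := (hΩo.prod isOpen_compl_singleton).measurableSet
  have hm : Measurable (S.indicator fun z : E N × E N => flux p A z.1 z.2) := by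
    classical
    rw [← piecewise_eq_indicator]
    exact ha.contDiffOn.continuousOn.measurable_piecewise continuousOn_const hS
  refine ((hm.comp_aemeasurable (aemeasurable_id.prodMk hG.aemeasurable)).congr
    ?_).aestronglyMeasurable
  filter_upwards [ae_restrict_mem hΩo.measurableSet, hA.homogeneous] with x hx hh
  simp only [Function.comp, id]
  by_cases h0 : G x = 0
  · rw [indicator_of_notMem (by simp [S, h0]), h0, flux_zero hA hx (hp1 x hx) hh]
  · rw [indicator_of_mem (show (x, G x) ∈ S from mk_mem_prod hx h0)]

/-- Replacing both numbers by their maximum serves in place of Young's inequality with conjugate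
exponents. -/
theorem rpow_sub_one_mul_le {a b q : ℝ} (ha : 0 ≤ a) (hb : 0 ≤ b) (hq : 1 < q) :
    a ^ (q - 1) * b ≤ a ^ q + b ^ q := by
  have hm : 0 ≤ max a b := le_max_of_le_left ha
  have h1 : a ^ (q - 1) * b ≤ max a b ^ (q - 1) * max a b :=
    mul_le_mul (Real.rpow_le_rpow ha (le_max_left _ _) (by linarith)) (le_max_right _ _) hb
      (by positivity)
  have h2 : max a b ^ (q - 1) * max a b = max a b ^ q := by
    conv_lhs => rw [← Real.rpow_one (max a b), ← Real.rpow_mul hm, one_mul]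
    rw [← Real.rpow_add_of_nonneg hm (by linarith) zero_le_one, sub_add_cancel]
  rw [h2] at h1
  refine h1.trans ?_
  rcases le_total a b with h | h
  · rw [max_eq_right h]; linarith [Real.rpow_nonneg ha q]
  · rw [max_eq_left h]; linarith [Real.rpow_nonneg hb q]

/-- The pairing `a(x, ∇w) · ∇φ` is integrable for `w, φ ∈ W^{1,p(x)}(Ω)`. -/
theorem integrable_fluxDensity (hΩo : IsOpen Ω) (hpm : AEMeasurable p (volume.restrict Ω))
    {p₀ : ℝ} (hp₀ : 1 < p₀) (hp : ∀ x ∈ Ω, p₀ ≤ p x) (hA : IsAdmissible Ω p A) (hΛ : 0 < Λ)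
    (ha : HasDerivBound Ω p (flux p A) Λ) {w φ : E N → ℝ} (hw : MemW Ω p w) (hφ : MemW Ω p φ) :
    Integrable (fluxDensity Ω (flux p A) w φ) (volume.restrict Ω) := by
  have hp0 : ∀ x ∈ Ω, 0 ≤ p x := fun x hx => by linarith [hp x hx]
  have iw := (memLpVar_iff_integrable hΩo.measurableSet hpm hp0).1 hw.2.2
  have iφ := (memLpVar_iff_integrable hΩo.measurableSet hpm hp0).1 hφ.2.2
  have hm := (aestronglyMeasurable_flux hΩo (fun x hx => hp₀.trans_le (hp x hx)) hA ha iw.1)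
  refine Integrable.mono' ((iw.2.add iφ.2).const_mul (Λ / (p₀ - 1))) (hm.inner iφ.1) ?_
  filter_upwards [ae_restrict_mem hΩo.measurableSet, hA.homogeneous] with x hx hh
  have hpx := hp x hx
  have hb := norm_flux_le hΩo hA ha hx (by linarith) hh (weakGrad Ω w x)
  have hc : Λ / (p x - 1) ≤ Λ / (p₀ - 1) := by
    gcongr
  have h1 := rpow_sub_one_mul_le (norm_nonneg (weakGrad Ω w x)) (norm_nonneg (weakGrad Ω φ x))
    (by linarith : 1 < p x)
  have hc0 : 0 ≤ Λ / (p₀ - 1) := div_nonneg hΛ.le (by linarith)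
  calc ‖fluxDensity Ω (flux p A) w φ x‖
      ≤ ‖flux p A x (weakGrad Ω w x)‖ * ‖weakGrad Ω φ x‖ := norm_inner_le_norm _ _
    _ ≤ Λ / (p₀ - 1) * ‖weakGrad Ω w x‖ ^ (p x - 1) * ‖weakGrad Ω φ x‖ := by
        gcongr
        exact hb.trans (by gcongr)
    _ ≤ Λ / (p₀ - 1) * (‖weakGrad Ω w x‖ ^ p x + ‖weakGrad Ω φ x‖ ^ p x) := by
        rw [mul_assoc]
        gcongr

end Flux

/-! ### The test functions `φᵢ` -/

section QuotTest

variable {u v : E N → ℝ} {G H : E N → E N} {r : ℝ}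

/-- This is the form `u f(v/u)`, with `f(q) = 1 - q^r` smooth on `(0, ∞)`, required by
`HasW0Grad.mul_comp_div`. -/
theorem quotTest_eq_mul {x : E N} (hu : 0 < u x) (hv : 0 < v x) :
    quotTest r u v u x = u x * (1 - (v x / u x) ^ r) := by
  rw [quotTest, Real.div_rpow hv.le hu.le, Real.rpow_sub_one hu.ne']
  field_simp

/-- One computation thus serves both test functions. -/
theorem quotTest_swap (u v : E N → ℝ) (r : ℝ) :
    quotTest r u v v = fun x => -quotTest r v u v x := by
  ext x
  simp only [quotTest]
  ring

/-- `(u^r - v^r) / u^{r-1}` belongs to `W_0^{1,1}(Ω)`, with the expected gradient. -/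
theorem HasW0Grad.quotTest (hu : HasW0Grad Ω u G) (hv : HasW0Grad Ω v H)
    (hupos : ∀ᵐ x ∂(volume.restrict Ω), 0 < u x) (hvpos : ∀ᵐ x ∂(volume.restrict Ω), 0 < v x)
    {a b : ℝ} (ha : 0 < a) (hab : ∀ᵐ x ∂(volume.restrict Ω), v x / u x ∈ Icc a b) :
    HasW0Grad Ω (quotTest r u v u) fun x =>
      (1 + (r - 1) * (v x / u x) ^ r) • G x - (r * (v x / u x) ^ (r - 1)) • H x := by
  have hf : ContDiffOn ℝ ∞ (fun q : ℝ => 1 - q ^ r) (Ioi 0) := fun q hq =>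
    (contDiffAt_const.sub (Real.contDiffAt_rpow_const_of_ne (ne_of_gt hq))).contDiffWithinAt
  refine (hu.mul_comp_div hv hupos ha hab hf).congr_ae ?_ ?_
  · filter_upwards [hupos, hvpos] with x hx hx' using (quotTest_eq_mul hx hx').symm
  · filter_upwards [hab] with x hx
    have hq : 0 < v x / u x := ha.trans_le hx.1
    have hd : deriv (fun q : ℝ => 1 - q ^ r) (v x / u x) = -(r * (v x / u x) ^ (r - 1)) :=
      ((Real.hasDerivAt_rpow_const (Or.inl hq.ne')).const_sub 1).deriv
    rw [hd, neg_smul, ← sub_eq_add_neg]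
    congr 2
    -- The coefficient of `G` is `f - q f' = 1 - q^r + r q^r`.
    rw [Real.rpow_sub_one hq.ne']
    generalize v x / u x = q at hq
    field_simp
    ring

theorem HasW0Grad.neg (hu : HasW0Grad Ω u G) : HasW0Grad Ω (fun x => -u x) fun x => -G x := by
  have h := hu.comp (f := fun s => -s) (C := 1) (by fun_prop) (by simp) (by simp)
  simpa using h

/-- The bounds on `v / u` bound the coefficients, so the function is dominated by `|u| + |v|` and
its gradient by `|∇u| + |∇v|`. -/
theorem memW0_quotTest (hΩo : IsOpen Ω) (hΩb : Bornology.IsBounded Ω)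
    (hpm : AEMeasurable p (volume.restrict Ω)) (hp0 : ∀ x ∈ Ω, 0 ≤ p x) {P : ℝ}
    (hP : ∀ x ∈ Ω, p x ≤ P) (hr : 1 ≤ r) (hu : MemW0 Ω p u) (hv : MemW0 Ω p v)
    (hupos : ∀ᵐ x ∂(volume.restrict Ω), 0 < u x) (hvpos : ∀ᵐ x ∂(volume.restrict Ω), 0 < v x)
    {a b : ℝ} (ha : 0 < a) (hab : ∀ᵐ x ∂(volume.restrict Ω), v x / u x ∈ Icc a b) :
    MemW0 Ω p (quotTest r u v u) := by
  have hW := hu.1.hasW0Grad.quotTest (r := r) hv.1.hasW0Grad hupos hvpos ha hab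
  have hΩm := hΩo.measurableSet
  have hwg := hW.weakGrad_ae_eq hΩo hΩb
  have hbd : ∀ᵐ x ∂(volume.restrict Ω),
      (v x / u x) ^ r ∈ Icc 0 (b ^ r) ∧ (v x / u x) ^ (r - 1) ∈ Icc 0 (b ^ (r - 1)) := by
    filter_upwards [hab] with x hx
    have hq : 0 ≤ v x / u x := ha.le.trans hx.1
    exact ⟨⟨Real.rpow_nonneg hq _, Real.rpow_le_rpow hq hx.2 (by linarith)⟩,
      Real.rpow_nonneg hq _, Real.rpow_le_rpow hq hx.2 (by linarith)⟩
  refine ⟨hW.memW0One hΩo hΩb, ?_, (hW.hasWeakGradient hΩm hΩb).weakGrad, ?_⟩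
  · refine MemLpVar.of_le hΩm hpm hp0 hP hu.2.1 hv.2.1 hW.integrable.1 (C := 1 + b ^ r) ?_
    filter_upwards [hupos, hvpos, hbd] with x hx hx' hq
    rw [quotTest_eq_mul hx hx', norm_mul, mul_comm]
    have h1 : ‖1 - (v x / u x) ^ r‖ ≤ 1 + b ^ r := by
      rw [Real.norm_eq_abs, abs_le]
      constructor <;> linarith [hq.1.1, hq.1.2]
    have h2 : 0 ≤ 1 + b ^ r := (norm_nonneg _).trans h1
    refine mul_le_mul h1 ?_ (norm_nonneg _) h2
    linarith [norm_nonneg (v x)]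
  · refine MemLpVar.congr_ae ?_ hwg.symm
    refine MemLpVar.of_le hΩm hpm hp0 hP hu.2.2.2 hv.2.2.2 hW.integrable_grad.1
      (C := (1 + (r - 1) * b ^ r) + r * b ^ (r - 1)) ?_
    filter_upwards [hbd] with x hq
    have h1 : ‖1 + (r - 1) * (v x / u x) ^ r‖ ≤ 1 + (r - 1) * b ^ r := by
      have h3 := mul_nonneg (sub_nonneg.2 hr) hq.1.1
      rw [Real.norm_of_nonneg (by linarith)]
      have := mul_le_mul_of_nonneg_left hq.1.2 (sub_nonneg.2 hr)
      linarith
    have h2 : ‖r * (v x / u x) ^ (r - 1)‖ ≤ r * b ^ (r - 1) := by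
      rw [Real.norm_of_nonneg (mul_nonneg (by linarith) hq.2.1)]
      exact mul_le_mul_of_nonneg_left hq.2.2 (by linarith)
    have e1 := (norm_nonneg _).trans h1
    have e2 := (norm_nonneg _).trans h2
    refine (norm_sub_le _ _).trans ?_
    rw [norm_smul, norm_smul]
    have m1 := mul_le_mul_of_nonneg_right h1 (norm_nonneg (weakGrad Ω u x))
    have m2 := mul_le_mul_of_nonneg_right h2 (norm_nonneg (weakGrad Ω v x))
    have m3 := mul_nonneg e1 (norm_nonneg (weakGrad Ω v x))
    have m4 := mul_nonneg e2 (norm_nonneg (weakGrad Ω u x))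
    linarith

theorem MemW0.neg (hΩo : IsOpen Ω) (hΩb : Bornology.IsBounded Ω) (hu : MemW0 Ω p u) :
    MemW0 Ω p fun x => -u x := by
  have hW := hu.1.hasW0Grad.neg
  refine ⟨hW.memW0One hΩo hΩb, ?_, (hW.hasWeakGradient hΩo.measurableSet hΩb).weakGrad, ?_⟩
  · exact ⟨hu.2.1.1.neg, by simpa using hu.2.1.2⟩
  · refine MemLpVar.congr_ae ?_ (hW.weakGrad_ae_eq hΩo hΩb).symm
    exact ⟨hu.2.2.2.1.neg, by simpa using hu.2.2.2.2⟩

end QuotTest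

theorem exists_ae_mem_Icc_div {α : Type*} [MeasurableSpace α] {μ : Measure α} {u v : α → ℝ}
    (hu : ∀ᵐ x ∂μ, 0 < u x) (hv : ∀ᵐ x ∂μ, 0 < v x) (h₁ : MemLp (fun x => u x / v x) ⊤ μ)
    (h₂ : MemLp (fun x => v x / u x) ⊤ μ) :
    ∃ a b : ℝ, 0 < a ∧ ∀ᵐ x ∂μ, v x / u x ∈ Icc a b := by
  have hbd : ∀ {f : α → ℝ}, MemLp f ⊤ μ → ∃ M : ℝ, 0 < M ∧ ∀ᵐ x ∂μ, f x ≤ M := fun {f} hf => by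
    have hlt := hf.2
    rw [eLpNorm_exponent_top] at hlt
    refine ⟨(eLpNormEssSup f μ).toReal + 1, by positivity, ?_⟩
    filter_upwards [ae_le_eLpNormEssSup (f := f) (μ := μ)] with x hx
    have h := ENNReal.toReal_mono hlt.ne hx
    rw [toReal_enorm] at h
    linarith [Real.le_norm_self (f x)]
  obtain ⟨M₁, hM₁, b₁⟩ := hbd h₁
  obtain ⟨M₂, hM₂, b₂⟩ := hbd h₂
  -- The lower bound for `v / u` is the inverse of the upper bound for `u / v`.
  refine ⟨1 / M₁, M₂, by positivity, ?_⟩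
  filter_upwards [hu, hv, b₁, b₂] with x hux hvx h1 h2
  refine ⟨?_, h2⟩
  rw [div_le_div_iff₀ hM₁ hux]
  rw [div_le_iff₀ hvx] at h1
  linarith

theorem exists_exponent_bounds (hΩb : Bornology.IsBounded Ω) (hΩn : Ω.Nonempty)
    (hp : ContinuousOn p (closure Ω)) (hp1 : ∀ x ∈ closure Ω, 1 < p x) :
    (∃ p₀, 1 < p₀ ∧ ∀ x ∈ Ω, p₀ ≤ p x) ∧ (∃ P, ∀ x ∈ Ω, p x ≤ P) ∧ ∀ x ∈ Ω, pMinus Ω p ≤ p x := by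
  have hc := hΩb.isCompact_closure
  obtain ⟨y, hy, hmin⟩ := hc.exists_isMinOn hΩn.closure hp
  obtain ⟨z, hz, hmax⟩ := hc.exists_isMaxOn hΩn.closure hp
  exact ⟨⟨p y, hp1 y hy, fun x hx => hmin (subset_closure hx)⟩,
    ⟨p z, fun x hx => hmax (subset_closure hx)⟩,
    fun x hx => csInf_le (hc.image_of_continuousOn hp).bddBelow
      (mem_image_of_mem p (subset_closure hx))⟩

/-- If two elements of `W_0^{1,1}(Ω)` have the same gradient, they coincide. -/
theorem HasW0Grad.ae_eq_of_grad_ae_eq (hN : 1 ≤ N) (hΩm : MeasurableSet Ω)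
    (hΩb : Bornology.IsBounded Ω) {u v : E N → ℝ} {G H : E N → E N} (hu : HasW0Grad Ω u G)
    (hv : HasW0Grad Ω v H) (h : G =ᵐ[volume.restrict Ω] H) : u =ᵐ[volume.restrict Ω] v := by
  have h0 : HasW0Grad Ω (fun x => u x - v x) fun _ => 0 :=
    (hu.sub hv).congr_ae EventuallyEq.rfl (h.mono fun x hx => sub_eq_zero.2 hx)
  filter_upwards [h0.ae_eq_zero hN hΩm hΩb] with x hx using sub_eq_zero.1 hx

end DiazSaa

/-! ### The Diaz–Saa inequality and its equality cases -/

theorem mainTheorem2 {N : ℕ} (hN : 1 ≤ N)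
    (Ω : Set (DiazSaa.E N)) (hΩo : IsOpen Ω) (hΩc : IsConnected Ω)
    (hΩb : Bornology.IsBounded Ω)
    (p : DiazSaa.E N → ℝ) (hp : ContinuousOn p (closure Ω)) (hp1 : ∀ x ∈ closure Ω, 1 < p x)
    (A : DiazSaa.E N → DiazSaa.E N → ℝ) (hA : DiazSaa.IsAdmissible Ω p A)
    (Λ : ℝ) (hΛ : 0 < Λ) (ha : DiazSaa.HasDerivBound Ω p (DiazSaa.flux p A) Λ)
    (r : ℝ) (hr : r ∈ Set.Icc 1 (DiazSaa.pMinus Ω p))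
    (w₁ w₂ : DiazSaa.E N → ℝ)
    (hw₁ : DiazSaa.MemW0 Ω p w₁) (hw₂ : DiazSaa.MemW0 Ω p w₂)
    (hpos₁ : ∀ᵐ x ∂(volume.restrict Ω), 0 < w₁ x)
    (hpos₂ : ∀ᵐ x ∂(volume.restrict Ω), 0 < w₂ x)
    (hq₁ : MemLp (fun x => w₁ x / w₂ x) ⊤ (volume.restrict Ω))
    (hq₂ : MemLp (fun x => w₂ x / w₁ x) ⊤ (volume.restrict Ω)) :
    -- the distributional pairings are well defined
    (DiazSaa.MemW0 Ω p (DiazSaa.quotTest r w₁ w₂ w₁) ∧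
      DiazSaa.MemW0 Ω p (DiazSaa.quotTest r w₁ w₂ w₂) ∧
      Integrable (DiazSaa.fluxDensity Ω (DiazSaa.flux p A) w₁ (DiazSaa.quotTest r w₁ w₂ w₁))
        (volume.restrict Ω) ∧
      Integrable (DiazSaa.fluxDensity Ω (DiazSaa.flux p A) w₂ (DiazSaa.quotTest r w₁ w₂ w₂))
        (volume.restrict Ω)) ∧
    -- the inequality
    0 ≤ DiazSaa.diazSaaForm Ω (DiazSaa.flux p A) r w₁ w₂ ∧
    -- the case of equality
    (DiazSaa.diazSaaForm Ω (DiazSaa.flux p A) r w₁ w₂ = 0 →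
      (DiazSaa.LocallyPositive Ω w₁ → DiazSaa.LocallyPositive Ω w₂ →
        (∃ c : ℝ, ∀ᵐ x ∂(volume.restrict Ω), w₁ x / w₂ x = c) ∧
        ((¬ ∀ᵐ x ∂(volume.restrict Ω), p x ≠ r → DiazSaa.weakGrad Ω w₁ x = 0) →
          ∀ᵐ x ∂(volume.restrict Ω), w₁ x = w₂ x)) ∧
      ((∀ᵐ x ∂(volume.restrict Ω), p x ≠ r) →
        ∀ᵐ x ∂(volume.restrict Ω), w₁ x = w₂ x)) := by
  have hΩm := hΩo.measurableSet
  obtain ⟨⟨p₀, hp₀, hpp₀⟩, ⟨P, hP⟩, hpm⟩ :=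
    DiazSaa.exists_exponent_bounds hΩb hΩc.nonempty hp hp1
  have hpmeas : AEMeasurable p (volume.restrict Ω) :=
    (hp.mono subset_closure).aemeasurable hΩm
  have hp0 : ∀ x ∈ Ω, 0 ≤ p x := fun x hx => by linarith [hpp₀ x hx]
  obtain ⟨a, b, ha0, hab⟩ := DiazSaa.exists_ae_mem_Icc_div hpos₁ hpos₂ hq₁ hq₂
  obtain ⟨a', b', ha0', hab'⟩ := DiazSaa.exists_ae_mem_Icc_div hpos₂ hpos₁ hq₂ hq₁
  have hG₁ := hw₁.1.hasW0Grad
  have hG₂ := hw₂.1.hasW0Grad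
  have hφ₁ := DiazSaa.memW0_quotTest hΩo hΩb hpmeas hp0 hP hr.1 hw₁ hw₂ hpos₁ hpos₂ ha0 hab
  have hφ₂ : DiazSaa.MemW0 Ω p (DiazSaa.quotTest r w₁ w₂ w₂) := by
    rw [DiazSaa.quotTest_swap]
    exact (DiazSaa.memW0_quotTest hΩo hΩb hpmeas hp0 hP hr.1 hw₂ hw₁ hpos₂ hpos₁ ha0' hab').neg
      hΩo hΩb
  have hi₁ := DiazSaa.integrable_fluxDensity hΩo hpmeas hp₀ hpp₀ hA hΛ ha hw₁.2 hφ₁.2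
  have hi₂ := DiazSaa.integrable_fluxDensity hΩo hpmeas hp₀ hpp₀ hA hΛ ha hw₂.2 hφ₂.2
  have hwg₁ := (hG₁.quotTest (r := r) hG₂ hpos₁ hpos₂ ha0 hab).weakGrad_ae_eq hΩo hΩb
  have hwg₂ := (hG₂.quotTest (r := r) hG₁ hpos₂ hpos₁ ha0' hab').neg.weakGrad_ae_eq hΩo hΩb
  rw [← DiazSaa.quotTest_swap] at hwg₂
  set D : DiazSaa.E N → ℝ := fun x =>
    DiazSaa.fluxDensity Ω (DiazSaa.flux p A) w₁ (DiazSaa.quotTest r w₁ w₂ w₁) x -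
      DiazSaa.fluxDensity Ω (DiazSaa.flux p A) w₂ (DiazSaa.quotTest r w₁ w₂ w₂) x with hD
  have hform : DiazSaa.diazSaaForm Ω (DiazSaa.flux p A) r w₁ w₂ = ∫ x in Ω, D x :=
    (integral_sub hi₁ hi₂).symm
  have hpt : ∀ᵐ x ∂(volume.restrict Ω), 0 ≤ D x ∧ (D x = 0 →
      (1 < r → w₂ x • DiazSaa.weakGrad Ω w₁ x = w₁ x • DiazSaa.weakGrad Ω w₂ x) ∧
        (p x ≠ r → DiazSaa.weakGrad Ω w₁ x = DiazSaa.weakGrad Ω w₂ x)) := by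
    filter_upwards [ae_restrict_mem hΩm, hA.homogeneous, hpos₁, hpos₂, hwg₁, hwg₂]
      with x hx hh h₁ h₂ e₁ e₂
    have h := DiazSaa.pointwise_diazSaa (hp₀.trans_le (hpp₀ x hx)) hr.1
      (hr.2.trans (hpm x hx)) (hA.strictConvex x hx) (hA.differentiable x hx) hh h₁ h₂
      (DiazSaa.weakGrad Ω w₁ x) (DiazSaa.weakGrad Ω w₂ x)
    simp only [hD, DiazSaa.fluxDensity]
    -- The sign in the gradient of `φ₂` turns the difference of densities into the symmetric sum of
    -- the pointwise inequality.
    rw [e₁, e₂, inner_neg_right, sub_neg_eq_add]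
    exact h
  have hD0 : 0 ≤ᵐ[volume.restrict Ω] D := hpt.mono fun x hx => hx.1
  refine ⟨⟨hφ₁, hφ₂, hi₁, hi₂⟩, hform ▸ integral_nonneg_of_ae hD0, fun heq => ?_⟩
  rw [hform, integral_eq_zero_iff_of_nonneg_ae hD0 (hi₁.sub hi₂)] at heq
  have hgrad : ∀ᵐ x ∂(volume.restrict Ω), p x ≠ r →
      DiazSaa.weakGrad Ω w₁ x = DiazSaa.weakGrad Ω w₂ x := by
    filter_upwards [hpt, heq] with x hx hx' using (hx.2 hx').2
  have hne : (∀ᵐ x ∂(volume.restrict Ω), p x ≠ r) →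
      ∀ᵐ x ∂(volume.restrict Ω), w₁ x = w₂ x := fun hpr => by
    refine hG₁.ae_eq_of_grad_ae_eq hN hΩm hΩb hG₂ ?_
    filter_upwards [hgrad, hpr] with x hx hx' using hx hx'
  refine ⟨fun hl₁ hl₂ => ?_, hne⟩
  -- For `r = 1` Young's inequality is always an equality and gives no proportionality, but then `p
  -- > r` everywhere and the gradients coincide.
  rcases hr.1.eq_or_lt with hr1 | hr1
  · have heq' := hne (by
      filter_upwards [ae_restrict_mem hΩm] with x hx
      rw [← hr1]
      exact (hp₀.trans_le (hpp₀ x hx)).ne')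
    refine ⟨⟨1, ?_⟩, fun _ => heq'⟩
    filter_upwards [heq', hpos₂] with x hx hx'
    rw [hx, div_self hx'.ne']
  · have hcol : ∀ᵐ x ∂(volume.restrict Ω),
        w₂ x • DiazSaa.weakGrad Ω w₁ x = w₁ x • DiazSaa.weakGrad Ω w₂ x := by
      filter_upwards [hpt, heq] with x hx hx' using (hx.2 hx').1 hr1
    obtain ⟨c, hc⟩ := hG₁.exists_div_ae_eq_const hΩo hΩc hΩb hG₂ hl₁ hl₂ hcol
    refine ⟨⟨c, hc⟩, fun hnz => ?_⟩
    -- Where `p ≠ r`, equal gradients and `w₁ = c w₂` give `(1 - c) w₂ ∇w₁ = 0`, so `c ≠ 1` would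
    -- make `∇w₁` vanish a.e. there.
    have hc1 : c = 1 := by
      by_contra hne1
      apply hnz
      filter_upwards [hc, hcol, hgrad, hpos₂] with x hxc hxl hxg hx₂ hpr
      have e := hxg hpr
      rw [div_eq_iff hx₂.ne'] at hxc
      rw [← e, hxc, mul_smul, ← sub_eq_zero, ← one_smul ℝ (w₂ x • _), smul_smul c 1, mul_one,
        ← sub_smul, smul_smul] at hxl
      exact (smul_eq_zero.1 hxl).resolve_left (mul_ne_zero (sub_ne_zero.2 (Ne.symm hne1)) hx₂.ne')
    filter_upwards [hc, hpos₂] with x hx hx₂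
    rw [hc1, div_eq_one_iff_eq hx₂.ne'] at hx
    exact hx
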